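/- Let $d\in\mathbb N$ and let $s,t>0$ satisfy $s+t>1$. Let $\Sigma_t^s(\mathbb R^d)$ be the Beurling type Gelfand--Shilov space of all $f\in C^\infty(\mathbb R^d)$ such that $$\|f\|_h=\sup_{\alpha,\beta\in\mathbb N^d,\ x\in\mathbb R^d}\frac{|x^\alpha D^\beta f(x)|}{h^{|\alpha+\beta|}\,\alpha!^{\,t}\,\beta!^{\,s}}<\infty\qquad\text{for every } h>0,$$ with the Fréchet topology defined by the norms $\|\cdot\|_h$, $h>0$, and let $(\Sigma_t^s)'(\mathbb R^d)$ be the space of continuous conjugate linear functionals $\phi\mapsto(u,\phi)$ on it. For $u\in(\Sigma_t^s)'(\mathbb R^d)$ and $\psi\in\Sigma_t^s(\mathbb R^d)\setminus 0$ let $$V_\psi u(x,\xi)=(2\pi)^{-d/2}\,\bigl(u,\ e^{i\langle\cdot,\xi\rangle}\psi(\cdot-x)\bigr),\qquad x,\xi\in\mathbb R^d,$$ be the short-time Fourier transform. For a set $U\subseteq T^*\mathbb R^d\setminus 0=\mathbb R^{2d}\setminus\{0\}$ consider the condition $$\sup_{\lambda>0,\ (x,\xi)\in U}e^{r\lambda}\,|V_\psi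 u(\lambda^t x,\lambda^s\xi)|<\infty\qquad\text{for all } r>0.\tag{$*$}$$ Let $\mathrm{WF}^{t,s}_\psi(u)$ be the set of all $z_0\in T^*\mathbb R^d\setminus 0$ for which there is no open set $U\subseteq T^*\mathbb R^d\setminus 0$ with $z_0\in U$ that satisfies $(*)$. Let $u\in(\Sigma_t^s)'(\mathbb R^d)$ and $\psi,\varphi\in\Sigma_t^s(\mathbb R^d)\setminus 0$. If $z_0\in T^*\mathbb R^d\setminus 0$ and $(*)$ holds for an open set $U\subseteq T^*\mathbb R^d\setminus 0$ containing $z_0$, then there exists an open set $V\subseteq U$ such that $z_0\in V$ and $$\sup_{\lambda>0,\ (x,\xi)\in V}e^{r\lambda}\,|V_\varphi u(\lambda^t x,\lambda^s\xi)|<\infty\qquad\text{for all } r>0.$$ Consequently $\mathrm{WF}^{t,s}_\psi(u)=\mathrm{WF}^{t,s}_\varphi(u)$: the anisotropic wave front set $\mathrm{WF}^{t,s}(u)$ does not depend on the window. -/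

import Mathlib

noncomputable section

namespace GelfandShilov

/-- Euclidean space `ℝ^d`. -/
abbrev RSpace (d : ℕ) : Type := EuclideanSpace ℝ (Fin d)

/-- Phase space `T^*ℝ^d = ℝ^d × ℝ^d` (only its topology is used). -/
abbrev PhaseSpace (d : ℕ) : Type := RSpace d × RSpace d

variable {d : ℕ}

section Spaces

open scoped ContDiff Nat

/-- The partial derivative `∂_i f`. -/
def pderiv (i : Fin d) (f : RSpace d → ℂ) : RSpace d → ℂ :=
  fun x => fderiv ℝ f x (EuclideanSpace.single i 1)

/-- `∂^β f = ∂_1^{β_1} ⋯ ∂_d^{β_d} f`; note `|D^β f| = |∂^β f|` for `D_j = -i ∂_j`. -/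
def multiDeriv (β : Fin d → ℕ) (f : RSpace d → ℂ) : RSpace d → ℂ :=
  (List.finRange d).foldr (fun i g => (pderiv i)^[β i] g) f

/-- The monomial `x^α = x_1^{α_1} ⋯ x_d^{α_d}`. -/
def monom (α : Fin d → ℕ) (x : RSpace d) : ℝ := ∏ i, x i ^ α i

/-- `α! = α_1! ⋯ α_d!`, as a real number. -/
def multiFactorial (α : Fin d → ℕ) : ℝ := ∏ i, ((α i)! : ℝ)

/-- The quotient `|x^α D^β f(x)| / (h^{|α+β|} α!^t β!^s)`. -/
def gsQuotient (t s h : ℝ) (f : RSpace d → ℂ)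
    (p : (Fin d → ℕ) × (Fin d → ℕ) × RSpace d) : ℝ :=
  ‖(monom p.1 p.2.2 : ℂ) * multiDeriv p.2.1 f p.2.2‖ /
    (h ^ (∑ i, (p.1 i + p.2.1 i)) * multiFactorial p.1 ^ t * multiFactorial p.2.1 ^ s)

/-! ### Algebra of partial derivatives -/

lemma contDiff_pderiv (i : Fin d) {f : RSpace d → ℂ} (hf : ContDiff ℝ ∞ f) :
    ContDiff ℝ ∞ (pderiv i f) :=
  (hf.fderiv_right (m := ∞) (by simp)).clm_apply contDiff_const

lemma pderiv_add (i : Fin d) {f g : RSpace d → ℂ} (hf : ContDiff ℝ ∞ f) (hg : ContDiff ℝ ∞ g) :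
    pderiv i (f + g) = pderiv i f + pderiv i g := by
  funext x
  simp only [pderiv, Pi.add_apply]
  rw [fderiv_add (hf.differentiable (by simp) x) (hg.differentiable (by simp) x)]
  rfl

lemma pderiv_smul (i : Fin d) (c : ℂ) {f : RSpace d → ℂ} (hf : ContDiff ℝ ∞ f) :
    pderiv i (c • f) = c • pderiv i f := by
  funext x
  simp only [pderiv, Pi.smul_apply]
  rw [fderiv_const_smul (hf.differentiable (by simp) x)]
  rfl

lemma pderiv_comm (i j : Fin d) {f : RSpace d → ℂ} (hf : ContDiff ℝ ∞ f) :
    pderiv i (pderiv j f) = pderiv j (pderiv i f) := by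
  have hd : Differentiable ℝ (fderiv ℝ f) :=
    (hf.fderiv_right (m := ∞) (by simp)).differentiable (by simp)
  funext x
  have key : ∀ v w : RSpace d,
      fderiv ℝ (fun y => fderiv ℝ f y v) x w = fderiv ℝ (fderiv ℝ f) x w v := by
    intro v w
    rw [fderiv_clm_apply (hd x) (differentiableAt_const v)]
    simp
  have hs : IsSymmSndFDerivAt ℝ f x := by
    refine (hf.contDiffAt (x := x)).isSymmSndFDerivAt ?_
    rw [minSmoothness_of_isRCLikeNormedField]
    exact WithTop.coe_le_coe.2 le_top
  unfold pderiv
  rw [key, key]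
  exact hs.eq _ _

/-- Iterated partial derivatives along a list of coordinates. -/
def listDeriv (l : List (Fin d)) (f : RSpace d → ℂ) : RSpace d → ℂ := l.foldr pderiv f

lemma multiDeriv_eq_listDeriv (β : Fin d → ℕ) (f : RSpace d → ℂ) :
    multiDeriv β f =
      listDeriv ((List.finRange d).flatMap fun i => List.replicate (β i) i) f := by
  unfold multiDeriv listDeriv
  induction List.finRange d with
  | nil => rfl
  | cons a L ih =>
    rw [List.foldr_cons, List.flatMap_cons, List.foldr_append, ← ih]
    generalize List.foldr (fun i g => (pderiv i)^[β i] g) f L = g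
    induction β a with
    | zero => rfl
    | succ n ihn => rw [Function.iterate_succ_apply', ihn, List.replicate_succ, List.foldr_cons]

lemma contDiff_listDeriv (l : List (Fin d)) {f : RSpace d → ℂ} (hf : ContDiff ℝ ∞ f) :
    ContDiff ℝ ∞ (listDeriv l f) := by
  induction l with
  | nil => exact hf
  | cons a L ih => exact contDiff_pderiv a ih

lemma listDeriv_add (l : List (Fin d)) {f g : RSpace d → ℂ} (hf : ContDiff ℝ ∞ f)
    (hg : ContDiff ℝ ∞ g) : listDeriv l (f + g) = listDeriv l f + listDeriv l g := by
  induction l with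
  | nil => rfl
  | cons a L ih =>
    change pderiv a (listDeriv L (f + g)) = _
    rw [ih, pderiv_add a (contDiff_listDeriv L hf) (contDiff_listDeriv L hg)]
    rfl

lemma listDeriv_smul (l : List (Fin d)) (c : ℂ) {f : RSpace d → ℂ} (hf : ContDiff ℝ ∞ f) :
    listDeriv l (c • f) = c • listDeriv l f := by
  induction l with
  | nil => rfl
  | cons a L ih =>
    change pderiv a (listDeriv L (c • f)) = _
    rw [ih, pderiv_smul a c (contDiff_listDeriv L hf)]
    rfl

lemma listDeriv_perm {l l' : List (Fin d)} (h : l.Perm l') {f : RSpace d → ℂ}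
    (hf : ContDiff ℝ ∞ f) : listDeriv l f = listDeriv l' f := by
  induction h with
  | nil => rfl
  | cons a _ ih => exact congrArg (pderiv a) ih
  | swap a b L => exact pderiv_comm b a (contDiff_listDeriv L hf)
  | trans _ _ ih₁ ih₂ => exact ih₁.trans ih₂

lemma listDeriv_eq_iteratedFDeriv (l : List (Fin d)) {f : RSpace d → ℂ} (hf : ContDiff ℝ ∞ f)
    (x : RSpace d) :
    listDeriv l f x =
      iteratedFDeriv ℝ l.length f x (fun j => EuclideanSpace.single (l.get j) (1 : ℝ)) := by
  induction l generalizing x with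
  | nil => simp [listDeriv]
  | cons a L ih =>
    have h1 : listDeriv L f = fun y =>
        iteratedFDeriv ℝ L.length f y (fun j => EuclideanSpace.single (L.get j) (1 : ℝ)) :=
      funext ih
    have hd : DifferentiableAt ℝ (iteratedFDeriv ℝ L.length f) x :=
      (hf.differentiable_iteratedFDeriv (m := L.length)
        (WithTop.coe_lt_coe.2 (ENat.natCast_lt_top _))) x
    change pderiv a (listDeriv L f) x = _
    rw [h1]
    unfold pderiv
    rw [fderiv_continuousMultilinear_apply_const_apply hd]
    exact (iteratedFDeriv_succ_apply_left (n := L.length) (f := f) (x := x)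
      (fun j => EuclideanSpace.single ((a :: L).get j) (1 : ℝ))).symm

lemma multiDeriv_add (β : Fin d → ℕ) {f g : RSpace d → ℂ} (hf : ContDiff ℝ ∞ f)
    (hg : ContDiff ℝ ∞ g) : multiDeriv β (f + g) = multiDeriv β f + multiDeriv β g := by
  simp only [multiDeriv_eq_listDeriv, listDeriv_add _ hf hg]

lemma multiDeriv_smul (β : Fin d → ℕ) (c : ℂ) {f : RSpace d → ℂ} (hf : ContDiff ℝ ∞ f) :
    multiDeriv β (c • f) = c • multiDeriv β f := by
  simp only [multiDeriv_eq_listDeriv, listDeriv_smul _ c hf]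

lemma multiDeriv_zero_fun (β : Fin d → ℕ) : multiDeriv β (0 : RSpace d → ℂ) = 0 := by
  simpa using multiDeriv_smul β 0 (f := (0 : RSpace d → ℂ)) contDiff_const

lemma multiFactorial_pos (α : Fin d → ℕ) : 0 < multiFactorial α :=
  Finset.prod_pos fun i _ => by exact_mod_cast Nat.factorial_pos (α i)

lemma gsDenom_pos {t s h : ℝ} (hh : 0 < h) (p : (Fin d → ℕ) × (Fin d → ℕ) × RSpace d) :
    0 < h ^ (∑ i, (p.1 i + p.2.1 i)) * multiFactorial p.1 ^ t * multiFactorial p.2.1 ^ s :=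
  mul_pos (mul_pos (pow_pos hh _) (Real.rpow_pos_of_pos (multiFactorial_pos _) _))
    (Real.rpow_pos_of_pos (multiFactorial_pos _) _)

lemma gsQuotient_nonneg {t s h : ℝ} (hh : 0 < h) (f : RSpace d → ℂ)
    (p : (Fin d → ℕ) × (Fin d → ℕ) × RSpace d) : 0 ≤ gsQuotient t s h f p :=
  div_nonneg (norm_nonneg _) (gsDenom_pos hh p).le

lemma gsQuotient_add_le {t s h : ℝ} (hh : 0 < h) {f g : RSpace d → ℂ} (hf : ContDiff ℝ ∞ f)
    (hg : ContDiff ℝ ∞ g) (p : (Fin d → ℕ) × (Fin d → ℕ) × RSpace d) :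
    gsQuotient t s h (f + g) p ≤ gsQuotient t s h f p + gsQuotient t s h g p := by
  unfold gsQuotient
  rw [← add_div, multiDeriv_add _ hf hg, Pi.add_apply, mul_add]
  exact div_le_div_of_nonneg_right (norm_add_le _ _) (gsDenom_pos hh p).le

lemma gsQuotient_smul {t s h : ℝ} (c : ℂ) {f : RSpace d → ℂ} (hf : ContDiff ℝ ∞ f)
    (p : (Fin d → ℕ) × (Fin d → ℕ) × RSpace d) :
    gsQuotient t s h (c • f) p = ‖c‖ * gsQuotient t s h f p := by
  unfold gsQuotient
  rw [multiDeriv_smul _ c hf, Pi.smul_apply, smul_eq_mul, mul_left_comm, norm_mul, mul_div_assoc]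

/-! ### The space `Σ_t^s(ℝ^d)` and its dual -/

/-- The smooth functions `f` with `sup |x^α D^β f(x)| / (h^{|α+β|} α!^t β!^s) < ∞`
for every `h > 0`. -/
def gsSubmodule (d : ℕ) (t s : ℝ) : Submodule ℂ (RSpace d → ℂ) where
  carrier := {f | ContDiff ℝ ∞ f ∧
    ∀ h : ℝ, 0 < h → BddAbove (Set.range (gsQuotient t s h f))}
  zero_mem' := by
    refine ⟨contDiff_const, fun h _ => ⟨0, ?_⟩⟩
    rintro _ ⟨p, rfl⟩
    simp [gsQuotient, multiDeriv_zero_fun]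
  add_mem' := by
    rintro f g ⟨hf, hf'⟩ ⟨hg, hg'⟩
    refine ⟨hf.add hg, fun h hh => ?_⟩
    obtain ⟨A, hA⟩ := hf' h hh
    obtain ⟨B, hB⟩ := hg' h hh
    refine ⟨A + B, ?_⟩
    rintro _ ⟨p, rfl⟩
    exact (gsQuotient_add_le hh hf hg p).trans (add_le_add (hA ⟨p, rfl⟩) (hB ⟨p, rfl⟩))
  smul_mem' := by
    rintro c f ⟨hf, hf'⟩
    refine ⟨contDiff_const.smul hf, fun h hh => ?_⟩
    obtain ⟨A, hA⟩ := hf' h hh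
    refine ⟨‖c‖ * A, ?_⟩
    rintro _ ⟨p, rfl⟩
    rw [gsQuotient_smul c hf p]
    exact mul_le_mul_of_nonneg_left (hA ⟨p, rfl⟩) (norm_nonneg _)

/-- The Beurling type Gelfand–Shilov space `Σ_t^s(ℝ^d)`, as a type of its own, so that it does
not inherit the topology of pointwise convergence. -/
def GSSpace (d : ℕ) (t s : ℝ) : Type := ↥(gsSubmodule d t s)

instance (t s : ℝ) : AddCommGroup (GSSpace d t s) :=
  inferInstanceAs (AddCommGroup ↥(gsSubmodule d t s))

instance (t s : ℝ) : Module ℂ (GSSpace d t s) :=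
  inferInstanceAs (Module ℂ ↥(gsSubmodule d t s))

/-- The function underlying an element of `Σ_t^s(ℝ^d)`. -/
def GSSpace.toFun {t s : ℝ} (f : GSSpace d t s) : RSpace d → ℂ := f.1

instance (t s : ℝ) : CoeFun (GSSpace d t s) (fun _ => RSpace d → ℂ) := ⟨GSSpace.toFun⟩

lemma GSSpace.contDiff {t s : ℝ} (f : GSSpace d t s) : ContDiff ℝ ∞ f.toFun := f.2.1

lemma GSSpace.bddAbove {t s : ℝ} (f : GSSpace d t s) {h : ℝ} (hh : 0 < h) :
    BddAbove (Set.range (gsQuotient t s h f.toFun)) := f.2.2 h hh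

/-- The norm `‖f‖_{S_{t,h}^s} = sup_{α,β,x} |x^α D^β f(x)| / (h^{|α+β|} α!^t β!^s)`,
a seminorm on `Σ_t^s(ℝ^d)` for `h > 0`. -/
def gsSeminorm (d : ℕ) (t s : ℝ) (h : Set.Ioi (0 : ℝ)) : Seminorm ℂ (GSSpace d t s) :=
  Seminorm.ofSMulLE (fun f => ⨆ p, gsQuotient t s h.1 f.toFun p)
    (by
      have : ∀ p, gsQuotient t s h.1 (GSSpace.toFun (0 : GSSpace d t s)) p = 0 := fun p => by
        change gsQuotient t s h.1 (0 : RSpace d → ℂ) p = 0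
        simp [gsQuotient, multiDeriv_zero_fun]
      simp only [this, ciSup_const])
    (fun f g => ciSup_le fun p => (gsQuotient_add_le h.2 f.contDiff g.contDiff p).trans
      (add_le_add (le_ciSup (f.bddAbove h.2) p) (le_ciSup (g.bddAbove h.2) p)))
    (fun c f => ciSup_le fun p => (gsQuotient_smul c f.contDiff p).trans_le
      (mul_le_mul_of_nonneg_left (le_ciSup (f.bddAbove h.2) p) (norm_nonneg c)))

/-- The Fréchet topology of `Σ_t^s(ℝ^d)`, defined by the seminorms `‖·‖_{S_{t,h}^s}`, `h > 0`. -/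
instance (t s : ℝ) : TopologicalSpace (GSSpace d t s) :=
  (show SeminormFamily ℂ (GSSpace d t s) (Set.Ioi (0 : ℝ)) from
    gsSeminorm d t s).moduleFilterBasis.topology

/-- The Gelfand–Shilov ultradistributions `(Σ_t^s)'(ℝ^d)`: the continuous conjugate linear
functionals `φ ↦ (u, φ)` on `Σ_t^s(ℝ^d)`. -/
abbrev GSDual (d : ℕ) (t s : ℝ) : Type := GSSpace d t s →L⋆[ℂ] ℂ

/-! ### Invariance under time-frequency shifts -/

lemma exists_pow_le {t : ℝ} (ht : 0 < t) {h : ℝ} (hh : 0 < h) {a : ℝ} (ha : 0 ≤ a) :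
    ∃ C : ℝ, 0 < C ∧ ∀ k : ℕ, a ^ k ≤ C * (h ^ k * (k ! : ℝ) ^ t) := by
  set b : ℝ := (a / h) ^ (1 / t) with hb
  have hah : 0 ≤ a / h := div_nonneg ha hh.le
  have hb0 : 0 ≤ b := Real.rpow_nonneg hah _
  have hbt : b ^ t = a / h := by
    rw [hb, ← Real.rpow_mul hah, one_div, inv_mul_cancel₀ ht.ne', Real.rpow_one]
  refine ⟨Real.exp b ^ t, Real.rpow_pos_of_pos (Real.exp_pos b) t, fun k => ?_⟩
  have h1 : b ^ k ≤ Real.exp b * k ! :=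
    (div_le_iff₀ (by positivity)).1 (Real.pow_div_factorial_le_exp b hb0 k)
  have h2 : (b ^ k) ^ t ≤ (Real.exp b * k !) ^ t :=
    Real.rpow_le_rpow (pow_nonneg hb0 k) h1 ht.le
  rw [Real.mul_rpow (Real.exp_pos b).le (by positivity)] at h2
  have h3 : (b ^ k) ^ t = (a / h) ^ k := by
    rw [← Real.rpow_natCast b k, ← Real.rpow_mul hb0, mul_comm, Real.rpow_mul hb0, hbt,
      Real.rpow_natCast]
  rw [h3, div_pow, div_le_iff₀ (pow_pos hh k)] at h2
  linarith

/-- The estimates defining `Σ_t^s`, with `|x|^k` and full derivatives in place of multi-indices. -/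
def NormEstimates (t s : ℝ) (f : RSpace d → ℂ) : Prop :=
  ∀ h : ℝ, 0 < h → ∃ C : ℝ, 0 ≤ C ∧ ∀ (k n : ℕ) (x : RSpace d),
    ‖x‖ ^ k * ‖iteratedFDeriv ℝ n f x‖ ≤ C * (h ^ (k + n) * (k ! : ℝ) ^ t * (n ! : ℝ) ^ s)

lemma factorial_sum_le (α : Fin d → ℕ) :
    ((∑ i, α i)! : ℝ) ≤ (d : ℝ) ^ (∑ i, α i) * multiFactorial α := by
  have h1 : Nat.multinomial Finset.univ α ≤ d ^ (∑ i, α i) := by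
    have := Finset.sum_pow_eq_sum_piAntidiag (Finset.univ : Finset (Fin d))
      (fun _ => (1 : ℕ)) (∑ i, α i)
    simp only [Finset.sum_const, Finset.card_univ, Fintype.card_fin, smul_eq_mul, mul_one, one_pow,
      Finset.prod_const_one, Nat.cast_id] at this
    rw [this]
    exact Finset.single_le_sum (f := fun k => Nat.multinomial Finset.univ k)
      (fun _ _ => Nat.zero_le _) (by simp [Finset.mem_piAntidiag])
  have h2 := Nat.multinomial_spec Finset.univ α
  rw [← h2]
  unfold multiFactorial
  push_cast
  rw [mul_comm]
  exact mul_le_mul_of_nonneg_right (by exact_mod_cast h1) (by positivity)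

lemma abs_monom_le (α : Fin d → ℕ) (x : RSpace d) : |monom α x| ≤ ‖x‖ ^ (∑ i, α i) := by
  unfold monom
  rw [Finset.abs_prod, ← Finset.prod_pow_eq_pow_sum]
  refine Finset.prod_le_prod (fun _ _ => abs_nonneg _) fun i _ => ?_
  rw [abs_pow]
  exact pow_le_pow_left₀ (abs_nonneg _) (by simpa using PiLp.norm_apply_le x i) _

lemma length_flat (β : Fin d → ℕ) :
    ((List.finRange d).flatMap fun i => List.replicate (β i) i).length = ∑ i, β i := by
  rw [List.length_flatMap]
  simp [Fin.sum_univ_def]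

lemma norm_multiDeriv_le (β : Fin d → ℕ) {f : RSpace d → ℂ} (hf : ContDiff ℝ ∞ f)
    (x : RSpace d) : ‖multiDeriv β f x‖ ≤ ‖iteratedFDeriv ℝ (∑ i, β i) f x‖ := by
  rw [multiDeriv_eq_listDeriv, listDeriv_eq_iteratedFDeriv _ hf, ← length_flat β]
  refine (ContinuousMultilinearMap.le_opNorm _ _).trans ?_
  simp

lemma norm_iteratedFDeriv_le_sum (n : ℕ) (f : RSpace d → ℂ) (x : RSpace d) :
    ‖iteratedFDeriv ℝ n f x‖ ≤ ∑ v : Fin n → Fin d,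
      ‖iteratedFDeriv ℝ n f x (fun j => EuclideanSpace.single (v j) (1 : ℝ))‖ := by
  refine ContinuousMultilinearMap.opNorm_le_bound (by positivity) fun m => ?_
  have hm : m = fun j => ∑ i, (m j i) • EuclideanSpace.single i (1 : ℝ) := by
    funext j
    ext k
    simp [Finset.sum_apply, Pi.single_apply]
  conv_lhs => rw [hm]
  rw [ContinuousMultilinearMap.map_sum]
  refine (norm_sum_le _ _).trans ?_
  rw [Finset.sum_mul]
  refine Finset.sum_le_sum fun v _ => ?_
  rw [ContinuousMultilinearMap.map_smul_univ, norm_smul, mul_comm]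
  refine mul_le_mul_of_nonneg_left ?_ (norm_nonneg _)
  rw [norm_prod]
  exact Finset.prod_le_prod (fun _ _ => norm_nonneg _) fun j _ => PiLp.norm_apply_le (m j) (v j)

lemma multiDeriv_count {n : ℕ} (v : Fin n → Fin d) {f : RSpace d → ℂ} (hf : ContDiff ℝ ∞ f)
    (x : RSpace d) :
    iteratedFDeriv ℝ n f x (fun j => EuclideanSpace.single (v j) (1 : ℝ)) =
      multiDeriv (fun i => (List.ofFn v).count i) f x := by
  rw [multiDeriv_eq_listDeriv]
  have hp : ((List.finRange d).flatMap
      fun i => List.replicate ((List.ofFn v).count i) i).Perm (List.ofFn v) := by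
    rw [List.perm_iff_count]
    intro a
    rw [List.count_flatMap]
    simp only [Function.comp_def, List.count_replicate]
    rw [← Fin.sum_univ_def]
    simp
  rw [listDeriv_perm hp hf, listDeriv_eq_iteratedFDeriv _ hf]
  have gen : ∀ (l : List (Fin d)) (hl : l.length = n),
      iteratedFDeriv ℝ n f x (fun j => EuclideanSpace.single (l.get (Fin.cast hl.symm j)) (1 : ℝ))
        = iteratedFDeriv ℝ l.length f x (fun j => EuclideanSpace.single (l.get j) (1 : ℝ)) := by
    intro l hl
    subst hl
    rfl
  rw [← gen (List.ofFn v) (by simp)]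
  simp

lemma sum_count_ofFn {n : ℕ} (v : Fin n → Fin d) : ∑ i, (List.ofFn v).count i = n := by
  have := Multiset.sum_count_eq_card (s := Finset.univ) (m := ((List.ofFn v : List (Fin d)) : Multiset (Fin d)))
    (fun a _ => Finset.mem_univ a)
  simpa using this

lemma multiFactorial_le (α : Fin d → ℕ) : multiFactorial α ≤ ((∑ i, α i)! : ℝ) := by
  unfold multiFactorial
  exact_mod_cast Nat.le_of_dvd (Nat.factorial_pos _)
    (Nat.prod_factorial_dvd_factorial_sum Finset.univ α)

lemma normEstimates_of_bddAbove {t s : ℝ} (ht : 0 < t) (hs : 0 < s) {f : RSpace d → ℂ}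
    (hf : ContDiff ℝ ∞ f) (H : ∀ h : ℝ, 0 < h → BddAbove (Set.range (gsQuotient t s h f))) :
    NormEstimates t s f := by
  intro h hh
  set D : ℝ := (d : ℝ) + 1 with hD
  have hD0 : 0 < D := by positivity
  obtain ⟨C, hC⟩ := H (h / D) (by positivity)
  have hest : ∀ (α β : Fin d → ℕ) (x : RSpace d),
      |monom α x| * ‖multiDeriv β f x‖ ≤ max C 0 * ((h / D) ^ (∑ i, α i + ∑ i, β i) *
        ((∑ i, α i)! : ℝ) ^ t * ((∑ i, β i)! : ℝ) ^ s) := by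
    intro α β x
    have h1 := hC ⟨(α, β, x), rfl⟩
    unfold gsQuotient at h1
    rw [div_le_iff₀ (gsDenom_pos (by positivity) _)] at h1
    simp only [norm_mul, Complex.norm_real, Real.norm_eq_abs, Finset.sum_add_distrib] at h1
    refine h1.trans ?_
    have := multiFactorial_pos α
    have := multiFactorial_pos β
    refine mul_le_mul (le_max_left _ _) ?_ (by positivity) (le_max_right _ _)
    gcongr
    · exact multiFactorial_le α
    · exact multiFactorial_le β
  refine ⟨max C 0, le_max_right _ _, fun k n x => ?_⟩
  -- a monomial dominating the power of the norm
  by_cases hk : ‖x‖ ^ k = 0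
  · rw [hk, zero_mul]; positivity
  have hmon : ∃ α : Fin d → ℕ, ∑ i, α i = k ∧ ‖x‖ ^ k ≤ D ^ k * |monom α x| := by
    rcases Nat.eq_zero_or_pos k with rfl | hk0
    · exact ⟨0, by simp [monom]⟩
    have hx : ‖x‖ ≠ 0 := fun h0 => hk (by rw [h0, zero_pow hk0.ne'])
    have hne : Nonempty (Fin d) := by
      by_contra hcon
      rw [not_nonempty_iff] at hcon
      exact hx (by simp [Subsingleton.elim x 0])
    obtain ⟨i, hi⟩ := Finite.exists_max (fun i => |x i|)
    refine ⟨Pi.single i k, by simp, ?_⟩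
    have hxi : ‖x‖ ≤ D * |x i| := by
      have h1 : x = ∑ j, (x j) • EuclideanSpace.single j (1 : ℝ) := by
        ext l
        simp [Finset.sum_apply, Pi.single_apply]
      calc ‖x‖ ≤ ∑ j, ‖(x j) • EuclideanSpace.single j (1 : ℝ)‖ := by
            conv_lhs => rw [h1]
            exact norm_sum_le _ _
        _ ≤ ∑ j : Fin d, |x i| := Finset.sum_le_sum fun j _ => by
            rw [norm_smul]; simpa using hi j
        _ = d * |x i| := by simp
        _ ≤ D * |x i| := mul_le_mul_of_nonneg_right (by linarith) (abs_nonneg _)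
    have hm : monom (Pi.single i k) x = x i ^ k := by
      unfold monom
      rw [Finset.prod_eq_single i]
      · simp
      · intro j _ hj
        simp [hj]
      · simp
    rw [hm, abs_pow, ← mul_pow]
    exact pow_le_pow_left₀ (norm_nonneg _) hxi k
  obtain ⟨α, hα, hαx⟩ := hmon
  calc ‖x‖ ^ k * ‖iteratedFDeriv ℝ n f x‖
      ≤ (D ^ k * |monom α x|) * ∑ v : Fin n → Fin d,
          ‖multiDeriv (fun i => (List.ofFn v).count i) f x‖ := by
        refine mul_le_mul hαx ?_ (norm_nonneg _) (by positivity)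
        simpa only [multiDeriv_count _ hf] using norm_iteratedFDeriv_le_sum n f x
    _ = D ^ k * ∑ v : Fin n → Fin d,
          |monom α x| * ‖multiDeriv (fun i => (List.ofFn v).count i) f x‖ := by
        rw [mul_assoc, Finset.mul_sum]
    _ ≤ D ^ k * ∑ v : Fin n → Fin d,
          max C 0 * ((h / D) ^ (k + n) * (k ! : ℝ) ^ t * (n ! : ℝ) ^ s) := by
        refine mul_le_mul_of_nonneg_left (Finset.sum_le_sum fun v _ => ?_) (by positivity)
        have := hest α (fun i => (List.ofFn v).count i) x
        rwa [hα, sum_count_ofFn] at this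
    _ = D ^ k * ((d : ℝ) ^ n * (max C 0 * ((h / D) ^ (k + n) * (k ! : ℝ) ^ t * (n ! : ℝ) ^ s))) := by
        simp
    _ ≤ D ^ k * (D ^ n * (max C 0 * ((h / D) ^ (k + n) * (k ! : ℝ) ^ t * (n ! : ℝ) ^ s))) := by
        gcongr
        linarith
    _ = max C 0 * (h ^ (k + n) * (k ! : ℝ) ^ t * (n ! : ℝ) ^ s) := by
        rw [div_pow, pow_add D]
        field_simp

lemma bddAbove_of_normEstimates {t s : ℝ} (ht : 0 < t) (hs : 0 < s) {f : RSpace d → ℂ}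
    (hf : ContDiff ℝ ∞ f) (H : NormEstimates t s f) (h : ℝ) (hh : 0 < h) :
    BddAbove (Set.range (gsQuotient t s h f)) := by
  set D : ℝ := (d : ℝ) + 1 with hD
  have hD1 : 1 ≤ D := by simp [hD]
  have hD0 : 0 < D := by positivity
  set A : ℝ := D ^ t * D ^ s with hA
  have hDt : 1 ≤ D ^ t := Real.one_le_rpow hD1 ht.le
  have hDs : 1 ≤ D ^ s := Real.one_le_rpow hD1 hs.le
  have hA0 : 0 < A := by positivity
  obtain ⟨C, hC0, hC⟩ := H (h / A) (by positivity)
  refine ⟨C, ?_⟩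
  rintro _ ⟨⟨α, β, x⟩, rfl⟩
  unfold gsQuotient
  rw [div_le_iff₀ (gsDenom_pos hh _)]
  simp only [norm_mul, Complex.norm_real, Real.norm_eq_abs, Finset.sum_add_distrib]
  set k := ∑ i, α i with hk
  set n := ∑ i, β i with hn
  have hα := multiFactorial_pos α
  have hβ := multiFactorial_pos β
  have hfac : ∀ (r : ℝ), 0 < r → ∀ γ : Fin d → ℕ,
      ((∑ i, γ i)! : ℝ) ^ r ≤ (D ^ r) ^ (∑ i, γ i) * multiFactorial γ ^ r := by
    intro r hr γ
    have h1 : ((∑ i, γ i)! : ℝ) ≤ D ^ (∑ i, γ i) * multiFactorial γ :=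
      (factorial_sum_le γ).trans (mul_le_mul_of_nonneg_right
        (pow_le_pow_left₀ (by positivity) (by linarith) _) (multiFactorial_pos γ).le)
    refine (Real.rpow_le_rpow (by positivity) h1 hr.le).trans_eq ?_
    rw [Real.mul_rpow (by positivity) (multiFactorial_pos γ).le]
    congr 1
    rw [← Real.rpow_natCast, ← Real.rpow_natCast, ← Real.rpow_mul hD0.le, ← Real.rpow_mul hD0.le,
      mul_comm]
  calc |monom α x| * ‖multiDeriv β f x‖ ≤ ‖x‖ ^ k * ‖iteratedFDeriv ℝ n f x‖ :=
        mul_le_mul (abs_monom_le α x) (norm_multiDeriv_le β hf x) (norm_nonneg _) (by positivity)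
    _ ≤ C * ((h / A) ^ (k + n) * (k ! : ℝ) ^ t * (n ! : ℝ) ^ s) := hC k n x
    _ ≤ C * ((h / A) ^ (k + n) * ((D ^ t) ^ k * multiFactorial α ^ t) *
          ((D ^ s) ^ n * multiFactorial β ^ s)) := by
        gcongr
        · exact hfac t ht α
        · exact hfac s hs β
    _ ≤ C * ((h / A) ^ (k + n) * (A ^ k * multiFactorial α ^ t) *
          (A ^ n * multiFactorial β ^ s)) := by
        gcongr
        · exact le_mul_of_one_le_right (by positivity) hDs
        · exact le_mul_of_one_le_left (by positivity) hDt
    _ = C * (h ^ (k + n) * multiFactorial α ^ t * multiFactorial β ^ s) := by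
        rw [div_pow, pow_add A]
        field_simp

lemma normEstimates_translate {t s : ℝ} (ht : 0 < t) {f : RSpace d → ℂ}
    (H : NormEstimates t s f) (a : RSpace d) : NormEstimates t s (fun y => f (y - a)) := by
  intro h hh
  obtain ⟨C, hC0, hC⟩ := H (h / 2) (by positivity)
  obtain ⟨B, hB0, hB⟩ := exists_pow_le ht (show 0 < h / 2 by positivity) (norm_nonneg a)
  refine ⟨(C + B * C), by positivity, fun k n x => ?_⟩
  rw [iteratedFDeriv_comp_sub]
  have hx : ‖x‖ ^ k ≤ 2 ^ k * (‖x - a‖ ^ k + ‖a‖ ^ k) := by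
    have h1 : ‖x‖ ≤ 2 * max ‖x - a‖ ‖a‖ := by
      have h2 : ‖x‖ ≤ ‖x - a‖ + ‖a‖ := by simpa using norm_add_le (x - a) a
      linarith [le_max_left ‖x - a‖ ‖a‖, le_max_right ‖x - a‖ ‖a‖]
    refine (pow_le_pow_left₀ (norm_nonneg _) h1 k).trans ?_
    rw [mul_pow]
    refine mul_le_mul_of_nonneg_left ?_ (by positivity)
    rcases max_choice ‖x - a‖ ‖a‖ with h3 | h3 <;> rw [h3]
    · exact le_add_of_nonneg_right (by positivity)
    · exact le_add_of_nonneg_left (by positivity)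
  have e1 := hC k n (x - a)
  have e2 := hC 0 n (x - a)
  simp only [pow_zero, one_mul, zero_add, Nat.factorial_zero, Nat.cast_one, Real.one_rpow,
    mul_one] at e2
  have e3 : ‖a‖ ^ k * ‖iteratedFDeriv ℝ n f (x - a)‖ ≤
      (B * ((h / 2) ^ k * (k ! : ℝ) ^ t)) * (C * ((h / 2) ^ n * (n ! : ℝ) ^ s)) :=
    mul_le_mul (hB k) e2 (norm_nonneg _) (by positivity)
  calc ‖x‖ ^ k * ‖iteratedFDeriv ℝ n f (x - a)‖
      ≤ 2 ^ k * (‖x - a‖ ^ k + ‖a‖ ^ k) * ‖iteratedFDeriv ℝ n f (x - a)‖ :=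
        mul_le_mul_of_nonneg_right hx (norm_nonneg _)
    _ = 2 ^ k * (‖x - a‖ ^ k * ‖iteratedFDeriv ℝ n f (x - a)‖
          + ‖a‖ ^ k * ‖iteratedFDeriv ℝ n f (x - a)‖) := by ring
    _ ≤ 2 ^ k * (C * ((h / 2) ^ (k + n) * (k ! : ℝ) ^ t * (n ! : ℝ) ^ s) +
          (B * ((h / 2) ^ k * (k ! : ℝ) ^ t)) * (C * ((h / 2) ^ n * (n ! : ℝ) ^ s))) := by
        gcongr
    _ = 2 ^ k * ((C + B * C) * ((h / 2) ^ (k + n) * (k ! : ℝ) ^ t * (n ! : ℝ) ^ s)) := by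
        ring
    _ ≤ 2 ^ (k + n) * ((C + B * C) * ((h / 2) ^ (k + n) * (k ! : ℝ) ^ t * (n ! : ℝ) ^ s)) := by
        gcongr
        · norm_num
        · omega
    _ = (C + B * C) * (h ^ (k + n) * (k ! : ℝ) ^ t * (n ! : ℝ) ^ s) := by
        rw [div_pow]
        field_simp

/-- The character `y ↦ e^{i⟨y, ξ⟩}`. -/
def character (ξ : RSpace d) (y : RSpace d) : ℂ :=
  Complex.exp (Complex.I * ((inner ℝ y ξ : ℝ) : ℂ))

lemma contDiff_expI : ContDiff ℝ ∞ (fun r : ℝ => Complex.exp (Complex.I * (r : ℂ))) :=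
  (contDiff_const.mul Complex.ofRealCLM.contDiff).cexp

lemma character_eq_comp (ξ : RSpace d) :
    character ξ = (fun r : ℝ => Complex.exp (Complex.I * (r : ℂ))) ∘ (innerSL ℝ ξ) := by
  funext y
  simp [character, real_inner_comm]

lemma contDiff_character (ξ : RSpace d) : ContDiff ℝ ∞ (character ξ) := by
  rw [character_eq_comp]
  exact contDiff_expI.comp (innerSL ℝ ξ).contDiff

lemma iteratedDeriv_expI (n : ℕ) (r : ℝ) :
    iteratedDeriv n (fun r : ℝ => Complex.exp (Complex.I * (r : ℂ))) r =
      Complex.I ^ n * Complex.exp (Complex.I * (r : ℂ)) := by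
  induction n generalizing r with
  | zero => simp
  | succ n ih =>
    rw [iteratedDeriv_succ, funext ih]
    have h1 : HasDerivAt (fun r : ℝ => Complex.exp (Complex.I * (r : ℂ)))
        (Complex.exp (Complex.I * (r : ℂ)) * (Complex.I * 1)) r :=
      ((Complex.ofRealCLM.hasDerivAt (x := r)).const_mul Complex.I).cexp
    rw [(h1.const_mul (Complex.I ^ n)).deriv]
    ring

lemma norm_iteratedFDeriv_character_le (ξ : RSpace d) (n : ℕ) (x : RSpace d) :
    ‖iteratedFDeriv ℝ n (character ξ) x‖ ≤ ‖ξ‖ ^ n := by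
  rw [character_eq_comp, ContinuousLinearMap.iteratedFDeriv_comp_right (innerSL ℝ ξ) contDiff_expI x
    (i := n) (WithTop.coe_le_coe.2 le_top)]
  refine (ContinuousMultilinearMap.norm_compContinuousLinearMap_le _ _).trans ?_
  rw [norm_iteratedFDeriv_eq_norm_iteratedDeriv, iteratedDeriv_expI, norm_mul,
    mul_comm Complex.I, Complex.norm_exp_ofReal_mul_I]
  simp

lemma normEstimates_modulate {t s : ℝ} (hs : 0 < s) {f : RSpace d → ℂ}
    (hf : ContDiff ℝ ∞ f) (H : NormEstimates t s f) (ξ : RSpace d) :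
    NormEstimates t s (fun y => character ξ y * f y) := by
  intro h hh
  obtain ⟨C, hC0, hC⟩ := H (h / 2) (by positivity)
  obtain ⟨B, hB0, hB⟩ := exists_pow_le hs (show 0 < h / 2 by positivity) (norm_nonneg ξ)
  refine ⟨B * C, by positivity, fun k n x => ?_⟩
  have hL := norm_iteratedFDeriv_mul_le (contDiff_character ξ) hf x (n := n)
    (WithTop.coe_le_coe.2 le_top)
  have hterm : ∀ i ∈ Finset.range (n + 1),
      ‖x‖ ^ k * ((n.choose i : ℝ) * ‖iteratedFDeriv ℝ i (character ξ) x‖ *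
        ‖iteratedFDeriv ℝ (n - i) f x‖) ≤
      (n.choose i : ℝ) * (B * C * ((h / 2) ^ (k + n) * (k ! : ℝ) ^ t * (n ! : ℝ) ^ s)) := by
    intro i hi
    have hin : i ≤ n := Nat.lt_succ_iff.1 (Finset.mem_range.1 hi)
    have e1 := (norm_iteratedFDeriv_character_le ξ i x).trans (hB i)
    have e2 := hC k (n - i) x
    have e3 := mul_le_mul e1 e2 (by positivity) (by positivity)
    have e4 : (i ! : ℝ) ^ s * ((n - i)! : ℝ) ^ s ≤ (n ! : ℝ) ^ s := by
      rw [← Real.mul_rpow (by positivity) (by positivity)]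
      refine Real.rpow_le_rpow (by positivity) ?_ hs.le
      exact_mod_cast Nat.le_of_dvd (Nat.factorial_pos _)
        (Nat.factorial_mul_factorial_dvd_factorial hin)
    calc ‖x‖ ^ k * ((n.choose i : ℝ) * ‖iteratedFDeriv ℝ i (character ξ) x‖ *
            ‖iteratedFDeriv ℝ (n - i) f x‖)
        = (n.choose i : ℝ) * (‖iteratedFDeriv ℝ i (character ξ) x‖ *
            (‖x‖ ^ k * ‖iteratedFDeriv ℝ (n - i) f x‖)) := by ring
      _ ≤ (n.choose i : ℝ) * (B * ((h / 2) ^ i * (i ! : ℝ) ^ s) *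
            (C * ((h / 2) ^ (k + (n - i)) * (k ! : ℝ) ^ t * ((n - i)! : ℝ) ^ s))) :=
          mul_le_mul_of_nonneg_left e3 (by positivity)
      _ = (n.choose i : ℝ) * (B * C * ((h / 2) ^ (i + (k + (n - i))) * (k ! : ℝ) ^ t *
            ((i ! : ℝ) ^ s * ((n - i)! : ℝ) ^ s))) := by
          rw [pow_add (h / 2) i]
          ring
      _ ≤ _ := by
          rw [show i + (k + (n - i)) = k + n by omega]
          gcongr
  have hsum : ∑ i ∈ Finset.range (n + 1), (n.choose i : ℝ) = 2 ^ n := by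
    exact_mod_cast Nat.sum_range_choose n
  calc ‖x‖ ^ k * ‖iteratedFDeriv ℝ n (fun y => character ξ y * f y) x‖
      ≤ ∑ i ∈ Finset.range (n + 1), ‖x‖ ^ k * ((n.choose i : ℝ) *
          ‖iteratedFDeriv ℝ i (character ξ) x‖ * ‖iteratedFDeriv ℝ (n - i) f x‖) := by
        rw [← Finset.mul_sum]
        exact mul_le_mul_of_nonneg_left hL (by positivity)
    _ ≤ 2 ^ n * (B * C * ((h / 2) ^ (k + n) * (k ! : ℝ) ^ t * (n ! : ℝ) ^ s)) := by
        rw [← hsum, Finset.sum_mul]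
        exact Finset.sum_le_sum hterm
    _ ≤ 2 ^ (k + n) * (B * C * ((h / 2) ^ (k + n) * (k ! : ℝ) ^ t * (n ! : ℝ) ^ s)) := by
        gcongr
        · norm_num
        · omega
    _ = B * C * (h ^ (k + n) * (k ! : ℝ) ^ t * (n ! : ℝ) ^ s) := by
        rw [div_pow]
        field_simp

end Spaces

section WaveFront

open scoped ContDiff

/-- The time-frequency shift `M_ξ T_x φ(y) = e^{i⟨y, ξ⟩} φ(y - x)`, as an element of
`Σ_t^s(ℝ^d)`. -/
def timeFreqShift {t s : ℝ} (ht : 0 < t) (hs : 0 < s) (x ξ : RSpace d) (φ : GSSpace d t s) :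
    GSSpace d t s :=
  ⟨fun y => Complex.exp (Complex.I * ((inner ℝ y ξ : ℝ) : ℂ)) * φ (y - x), by
    have h1 : ContDiff ℝ ∞ (fun y => φ.toFun (y - x)) :=
      φ.contDiff.comp (contDiff_id.sub contDiff_const)
    have h2 : ContDiff ℝ ∞ (fun y => character ξ y * φ.toFun (y - x)) :=
      (contDiff_character ξ).mul h1
    exact ⟨h2, bddAbove_of_normEstimates ht hs h2 (normEstimates_modulate hs h1
      (normEstimates_translate ht (normEstimates_of_bddAbove ht hs φ.contDiff
        fun _ hh => φ.bddAbove hh) x) ξ)⟩⟩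

/-! ### The short-time Fourier transform and the wave front set -/

/-- The short-time Fourier transform `V_φ u(x, ξ) = (2π)^{-d/2} (u, M_ξ T_x φ)`. -/
def stft {t s : ℝ} (ht : 0 < t) (hs : 0 < s) (φ : GSSpace d t s) (u : GSDual d t s)
    (z : PhaseSpace d) : ℂ :=
  (((2 * Real.pi) ^ (-((d : ℝ) / 2)) : ℝ) : ℂ) * u (timeFreqShift ht hs z.1 z.2 φ)

/-- The condition
`sup_{λ > 0, (x,ξ) ∈ U} e^{rλ} |V_ψ u(λ^t x, λ^s ξ)| < ∞` for all `r > 0`. -/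
def SuperExpDecay {t s : ℝ} (ht : 0 < t) (hs : 0 < s) (ψ : GSSpace d t s) (u : GSDual d t s)
    (U : Set (PhaseSpace d)) : Prop :=
  ∀ r : ℝ, 0 < r → ∃ C : ℝ, ∀ l : ℝ, 0 < l → ∀ z ∈ U,
    Real.exp (r * l) * ‖stft ht hs ψ u (l ^ t • z.1, l ^ s • z.2)‖ ≤ C

/-- The wave front set `WF^{t,s}(u) ⊆ T^*ℝ^d ∖ 0`, computed with the window `ψ`. -/
def waveFrontSet {t s : ℝ} (ht : 0 < t) (hs : 0 < s) (ψ : GSSpace d t s) (u : GSDual d t s) :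
    Set (PhaseSpace d) :=
  {z | z ≠ 0 ∧ ¬ ∃ U : Set (PhaseSpace d),
    IsOpen U ∧ U ⊆ {0}ᶜ ∧ z ∈ U ∧ SuperExpDecay ht hs ψ u U}

end WaveFront

end GelfandShilov

end

/-!
The inversion formula writes the time-frequency shift `π(z)φ` as `c ∫ a(w) π(z + w)ψ dw`, up to
unimodular factors in the integrand, where the pairing `a` of `φ` with the shifts of `ψ` decays
faster than every `exp(-r |w|)`, with `|(x, ξ)| = ‖x‖^{1/t} + ‖ξ‖^{1/s}`. The integral converges in
`Σ_t^s`, so `u` passes under it and `|V_φ u(z)| ≤ c ∫ |a(w)| |V_ψ u(z + w)| dw`. The weight is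
homogeneous of degree one under `(x, ξ) ↦ (λ^t x, λ^s ξ)`: for `z` in the dilate of a small
neighbourhood of `z₀`, points with `|w| ≤ ελ` keep `z + w` in the dilate of `U`, where the
hypothesis applies, and for `|w| > ελ` the decay of `a` absorbs the moderate growth of `V_ψ u` and
the factor `exp(ρλ)`.
-/

noncomputable section

namespace GelfandShilov

variable {d : ℕ}

section RealPowers

open scoped Nat

lemma continuous_norm_rpow_inv {E : Type*} [SeminormedAddCommGroup E] {t : ℝ} (ht : 0 < t) :
    Continuous fun x : E => ‖x‖ ^ t⁻¹ :=
  continuous_norm.rpow_const fun _ => Or.inr (inv_pos.2 ht).le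

lemma norm_add_rpow_inv_le {E : Type*} [SeminormedAddCommGroup E] {t : ℝ} (ht : 0 < t) (x y : E) :
    ‖x + y‖ ^ t⁻¹ ≤ 2 ^ t⁻¹ * (‖x‖ ^ t⁻¹ + ‖y‖ ^ t⁻¹) := by
  wlog hxy : ‖x‖ ≤ ‖y‖ generalizing x y
  · rw [add_comm x y, add_comm (‖x‖ ^ t⁻¹)]
    exact this y x (le_of_not_ge hxy)
  have hti : 0 ≤ t⁻¹ := (inv_pos.2 ht).le
  calc ‖x + y‖ ^ t⁻¹ ≤ (2 * ‖y‖) ^ t⁻¹ :=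
        Real.rpow_le_rpow (norm_nonneg _) ((norm_add_le x y).trans (by linarith)) hti
    _ = 2 ^ t⁻¹ * ‖y‖ ^ t⁻¹ := Real.mul_rpow zero_le_two (norm_nonneg y)
    _ ≤ _ := by
      gcongr
      exact le_add_of_nonneg_left (by positivity)

lemma norm_rpow_smul_rpow_inv {E : Type*} [SeminormedAddCommGroup E] [NormedSpace ℝ E] {t l : ℝ}
    (ht : 0 < t) (hl : 0 ≤ l) (x : E) : ‖l ^ t • x‖ ^ t⁻¹ = l * ‖x‖ ^ t⁻¹ := by
  rw [norm_smul, Real.norm_of_nonneg (by positivity),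
    Real.mul_rpow (by positivity) (norm_nonneg _), Real.rpow_rpow_inv hl ht.ne']

lemma pow_le_exp_mul_factorial_rpow {t h a : ℝ} (ht : 0 < t) (hh : 0 < h) (ha : 0 ≤ a) (k : ℕ) :
    a ^ k ≤ Real.exp (t * (a / h) ^ t⁻¹) * (h ^ k * (k ! : ℝ) ^ t) := by
  set b : ℝ := (a / h) ^ t⁻¹
  have hb0 : 0 ≤ b := by positivity
  have hbt : b ^ t = a / h := Real.rpow_inv_rpow (by positivity) ht.ne'
  have hpow : b ^ k ≤ Real.exp b * k ! :=
    (div_le_iff₀ (by positivity)).1 (Real.pow_div_factorial_le_exp b hb0 k)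
  have hrpow : (a / h) ^ k ≤ Real.exp (t * b) * (k ! : ℝ) ^ t := by
    calc (a / h) ^ k = (b ^ k) ^ t := by rw [← hbt, Real.rpow_pow_comm hb0]
      _ ≤ (Real.exp b * k !) ^ t := Real.rpow_le_rpow (by positivity) hpow ht.le
      _ = Real.exp (t * b) * (k ! : ℝ) ^ t := by
        rw [Real.mul_rpow (by positivity) (by positivity), ← Real.exp_mul, mul_comm b]
  rw [div_pow, div_le_iff₀ (by positivity)] at hrpow
  linarith

lemma mul_exp_half_le_of_forall_mul_pow_le {Q M b : ℝ} (H : ∀ k : ℕ, Q * b ^ k ≤ M * k !) :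
    Q * Real.exp (b / 2) ≤ M * 2 := by
  have hexp : HasSum (fun k : ℕ => Q * ((b / 2) ^ k / k !)) (Q * Real.exp (b / 2)) := by
    rw [Real.exp_eq_exp_ℝ]
    exact (NormedSpace.expSeries_div_hasSum_exp (b / 2)).mul_left _
  refine hasSum_le (fun k => ?_) hexp (hasSum_geometric_two.mul_left M)
  calc Q * ((b / 2) ^ k / k !) = Q * b ^ k * ((1 / 2) ^ k / k !) := by
        rw [div_pow, one_div_pow]; ring
    _ ≤ M * k ! * ((1 / 2) ^ k / k !) := mul_le_mul_of_nonneg_right (H k) (by positivity)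
    _ = M * (1 / 2) ^ k := by field_simp

lemma mul_exp_le_of_forall_mul_pow_le {t h Q M a : ℝ} (ht : 0 < t) (hh : 0 < h) (hQ : 0 ≤ Q)
    (hM : 0 ≤ M) (ha : 0 ≤ a) (H : ∀ k : ℕ, Q * a ^ k ≤ M * (h ^ k * (k ! : ℝ) ^ t)) :
    Q * Real.exp (t / 2 * (a / h) ^ t⁻¹) ≤ 2 ^ t * M := by
  have hti : 0 ≤ t⁻¹ := (inv_pos.2 ht).le
  set b : ℝ := (a / h) ^ t⁻¹ with hb
  have hroot (k : ℕ) : Q ^ t⁻¹ * b ^ k ≤ M ^ t⁻¹ * k ! := by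
    have hdiv : Q * (a / h) ^ k ≤ M * (k ! : ℝ) ^ t := by
      rw [div_pow, ← mul_div_assoc, div_le_iff₀ (by positivity)]
      linarith [H k]
    calc Q ^ t⁻¹ * b ^ k = (Q * (a / h) ^ k) ^ t⁻¹ := by
          rw [Real.mul_rpow hQ (by positivity), hb, Real.rpow_pow_comm (by positivity)]
      _ ≤ (M * (k ! : ℝ) ^ t) ^ t⁻¹ := Real.rpow_le_rpow (by positivity) hdiv hti
      _ = M ^ t⁻¹ * k ! := by
          rw [Real.mul_rpow hM (by positivity), Real.rpow_rpow_inv (by positivity) ht.ne']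
  calc Q * Real.exp (t / 2 * b) = (Q ^ t⁻¹ * Real.exp (b / 2)) ^ t := by
        rw [Real.mul_rpow (by positivity) (by positivity), Real.rpow_inv_rpow hQ ht.ne',
          ← Real.exp_mul, div_mul_eq_mul_div, div_mul_eq_mul_div, mul_comm b]
    _ ≤ (M ^ t⁻¹ * 2) ^ t := Real.rpow_le_rpow (by positivity)
        (mul_exp_half_le_of_forall_mul_pow_le hroot) ht.le
    _ = 2 ^ t * M := by
        rw [Real.mul_rpow (by positivity) zero_le_two, Real.rpow_inv_rpow hM ht.ne', mul_comm]

lemma exists_pow_le_exp_rpow_inv {t : ℝ} (ht : 0 < t) (k : ℕ) :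
    ∃ K : ℝ, 0 < K ∧ ∀ a : ℝ, 0 ≤ a → a ^ k ≤ K * Real.exp (a ^ t⁻¹) := by
  refine ⟨(t ^ t) ^ k * (k ! : ℝ) ^ t, by positivity, fun a ha => ?_⟩
  have h := pow_le_exp_mul_factorial_rpow ht (by positivity : 0 < t ^ t) ha k
  rwa [Real.div_rpow ha (by positivity), Real.rpow_rpow_inv ht.le ht.ne', mul_div_cancel₀ _ ht.ne',
    mul_comm] at h

lemma exists_succ_rpow_le {s : ℝ} (hs : 0 < s) :
    ∃ K : ℝ, 0 < K ∧ ∀ n : ℕ, ((n : ℝ) + 1) ^ s ≤ K * 2 ^ n := by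
  set c : ℝ := Real.log 2 / s with hc
  have hc0 : 0 < c := div_pos (Real.log_pos one_lt_two) hs
  refine ⟨2 / c ^ s, by positivity, fun n => ?_⟩
  have hexp : c * (n + 1) ≤ Real.exp (c * (n + 1)) := by
    linarith [Real.add_one_le_exp (c * ((n : ℝ) + 1))]
  have hrpow : c ^ s * ((n : ℝ) + 1) ^ s ≤ 2 * 2 ^ n :=
    calc c ^ s * ((n : ℝ) + 1) ^ s = (c * (n + 1)) ^ s :=
          (Real.mul_rpow hc0.le (by positivity)).symm
      _ ≤ Real.exp (c * (n + 1)) ^ s := Real.rpow_le_rpow (by positivity) hexp hs.le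
      _ = Real.exp (((n + 1 : ℕ) : ℝ) * Real.log 2) := by
          rw [← Real.exp_mul, hc]
          congr 1
          push_cast
          field_simp
      _ = 2 * 2 ^ n := by rw [Real.exp_nat_mul, Real.exp_log two_pos, pow_succ']
  rw [div_mul_eq_mul_div, le_div_iff₀ (by positivity)]
  linarith

lemma factorial_rpow_mul_le {s : ℝ} (hs : 0 ≤ s) {i n : ℕ} (hin : i ≤ n) :
    (i ! : ℝ) ^ s * ((n - i)! : ℝ) ^ s ≤ (n ! : ℝ) ^ s := by
  rw [← Real.mul_rpow (by positivity) (by positivity)]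
  refine Real.rpow_le_rpow (by positivity) ?_ hs
  exact_mod_cast Nat.le_of_dvd (Nat.factorial_pos _)
    (Nat.factorial_mul_factorial_dvd_factorial hin)

end RealPowers

section GevreyBounds

open scoped ContDiff Nat

variable {E F : Type*} [NormedAddCommGroup E] [NormedSpace ℝ E] [NormedAddCommGroup F]
  [NormedSpace ℝ F] {t s h r C C' : ℝ}

/-- The Gevrey estimates `‖D^n f(x)‖ ≤ C h^n n!^s` of order `s` for all derivatives of `f` at the
point `x`. -/
def GevreyBoundAt (s h C : ℝ) (f : E → F) (x : E) : Prop :=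
  ∀ n : ℕ, ‖iteratedFDeriv ℝ n f x‖ ≤ C * (h ^ n * (n ! : ℝ) ^ s)

lemma GevreyBoundAt.nonneg {f : E → F} {x : E} (H : GevreyBoundAt s h C f x) : 0 ≤ C := by
  simpa using (norm_nonneg _).trans (H 0)

lemma GevreyBoundAt.mono {f : E → F} {x : E} (H : GevreyBoundAt s h C f x) (hh : 0 ≤ h)
    (hC : C ≤ C') : GevreyBoundAt s h C' f x := fun n =>
  (H n).trans (mul_le_mul_of_nonneg_right hC (by positivity))

lemma GevreyBoundAt.add {f g : E → F} {x : E} (hf : ContDiff ℝ ∞ f) (hg : ContDiff ℝ ∞ g)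
    (Hf : GevreyBoundAt s h C f x) (Hg : GevreyBoundAt s h C' g x) :
    GevreyBoundAt s h (C + C') (f + g) x := fun n => by
  rw [iteratedFDeriv_add_apply (hf.of_le (mod_cast le_top)).contDiffAt
    (hg.of_le (mod_cast le_top)).contDiffAt, add_mul]
  exact (norm_add_le _ _).trans (add_le_add (Hf n) (Hg n))

lemma GevreyBoundAt.mul {A : Type*} [NormedRing A] [NormedAlgebra ℝ A] {f g : E → A} {x : E}
    (hs : 0 ≤ s) (hh : 0 ≤ h) (hf : ContDiff ℝ ∞ f) (hg : ContDiff ℝ ∞ g)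
    (Hf : GevreyBoundAt s h C f x) (Hg : GevreyBoundAt s h C' g x) :
    GevreyBoundAt s (2 * h) (C * C') (fun y => f y * g y) x := fun n => by
  have hterm : ∀ i ∈ Finset.range (n + 1),
      (n.choose i : ℝ) * ‖iteratedFDeriv ℝ i f x‖ * ‖iteratedFDeriv ℝ (n - i) g x‖ ≤
        (n.choose i : ℝ) * (C * C' * (h ^ n * (n ! : ℝ) ^ s)) := by
    intro i hi
    have hin : i ≤ n := Finset.mem_range_succ_iff.1 hi
    have hC := Hf.nonneg
    have hC' := Hg.nonneg
    rw [mul_assoc]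
    refine mul_le_mul_of_nonneg_left ?_ (Nat.cast_nonneg _)
    calc ‖iteratedFDeriv ℝ i f x‖ * ‖iteratedFDeriv ℝ (n - i) g x‖
        ≤ C * (h ^ i * (i ! : ℝ) ^ s) * (C' * (h ^ (n - i) * ((n - i)! : ℝ) ^ s)) :=
          mul_le_mul (Hf i) (Hg (n - i)) (norm_nonneg _) (by positivity)
      _ = C * C' * (h ^ n * ((i ! : ℝ) ^ s * ((n - i)! : ℝ) ^ s)) := by
          rw [← pow_mul_pow_sub h hin]; ring
      _ ≤ C * C' * (h ^ n * (n ! : ℝ) ^ s) := by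
          gcongr
          exact factorial_rpow_mul_le hs hin
  calc ‖iteratedFDeriv ℝ n (fun y => f y * g y) x‖
      ≤ ∑ i ∈ Finset.range (n + 1),
        (n.choose i : ℝ) * ‖iteratedFDeriv ℝ i f x‖ * ‖iteratedFDeriv ℝ (n - i) g x‖ :=
        norm_iteratedFDeriv_mul_le hf hg x (mod_cast le_top)
    _ ≤ ∑ i ∈ Finset.range (n + 1), (n.choose i : ℝ) * (C * C' * (h ^ n * (n ! : ℝ) ^ s)) :=
        Finset.sum_le_sum hterm
    _ = C * C' * ((2 * h) ^ n * (n ! : ℝ) ^ s) := by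
        rw [← Finset.sum_mul, ← Nat.cast_sum, Nat.sum_range_choose, mul_pow]
        push_cast
        ring

/-- `f` is smooth and `‖D^n f(x)‖ ≤ C h^n n!^s exp(-r ‖x‖^{1/t})` for all `n` and `x`. If such a
`C` exists for all `h, r > 0` then `f` belongs to `Σ_t^s`, and conversely. -/
structure GevreyDecay (t s h r C : ℝ) (f : E → F) : Prop where
  contDiff : ContDiff ℝ ∞ f
  boundAt (x : E) : GevreyBoundAt s h (C * Real.exp (-(r * ‖x‖ ^ t⁻¹))) f x

namespace GevreyDecay

lemma nonneg {f : E → F} (H : GevreyDecay t s h r C f) : 0 ≤ C :=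
  nonneg_of_mul_nonneg_left (H.boundAt 0).nonneg (Real.exp_pos _)

lemma mono {f : E → F} (H : GevreyDecay t s h r C f) (hh : 0 ≤ h) (hC : C ≤ C') :
    GevreyDecay t s h r C' f :=
  ⟨H.contDiff, fun x => (H.boundAt x).mono hh (by gcongr)⟩

lemma add {f g : E → F} (Hf : GevreyDecay t s h r C f) (Hg : GevreyDecay t s h r C' g) :
    GevreyDecay t s h r (C + C') (f + g) :=
  ⟨Hf.contDiff.add Hg.contDiff, fun x => by
    rw [add_mul]
    exact (Hf.boundAt x).add Hf.contDiff Hg.contDiff (Hg.boundAt x)⟩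

lemma norm_le {f : E → F} (H : GevreyDecay t s h r C f) (x : E) :
    ‖f x‖ ≤ C * Real.exp (-(r * ‖x‖ ^ t⁻¹)) := by
  simpa using H.boundAt x 0

end GevreyDecay

end GevreyBounds

section GelfandShilovEstimates

open scoped ContDiff Nat

variable {t s : ℝ}

lemma NormEstimates.exists_gevreyDecay {f : RSpace d → ℂ} (H : NormEstimates t s f)
    (hf : ContDiff ℝ ∞ f) (ht : 0 < t) {h r : ℝ} (hh : 0 < h) (hr : 0 < r) :
    ∃ C : ℝ, GevreyDecay t s h r C f := by
  set g : ℝ := (t / (2 * r)) ^ t with hg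
  have hg0 : 0 < g := by positivity
  obtain ⟨C, hC0, hC⟩ := H (min h g) (lt_min hh hg0)
  refine ⟨2 ^ t * C, hf, fun x n => ?_⟩
  have hexponent : t / 2 * (‖x‖ / g) ^ t⁻¹ = r * ‖x‖ ^ t⁻¹ := by
    rw [Real.div_rpow (norm_nonneg x) hg0.le, hg, Real.rpow_rpow_inv (by positivity) ht.ne']
    field_simp
  have hexp := mul_exp_le_of_forall_mul_pow_le (Q := ‖iteratedFDeriv ℝ n f x‖)
    (M := C * (h ^ n * (n ! : ℝ) ^ s)) ht hg0 (norm_nonneg _) (by positivity) (norm_nonneg x)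
    fun k => by
      calc ‖iteratedFDeriv ℝ n f x‖ * ‖x‖ ^ k
          = ‖x‖ ^ k * ‖iteratedFDeriv ℝ n f x‖ := mul_comm _ _
        _ ≤ C * (min h g ^ (k + n) * (k ! : ℝ) ^ t * (n ! : ℝ) ^ s) := hC k n x
        _ ≤ C * (g ^ k * h ^ n * (k ! : ℝ) ^ t * (n ! : ℝ) ^ s) := by
          rw [pow_add]
          gcongr
          · exact min_le_right _ _
          · exact min_le_left _ _
        _ = C * (h ^ n * (n ! : ℝ) ^ s) * (g ^ k * (k ! : ℝ) ^ t) := by ring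
  rw [hexponent] at hexp
  calc ‖iteratedFDeriv ℝ n f x‖
      = ‖iteratedFDeriv ℝ n f x‖ * Real.exp (r * ‖x‖ ^ t⁻¹) * Real.exp (-(r * ‖x‖ ^ t⁻¹)) := by
        rw [mul_assoc, ← Real.exp_add, add_neg_cancel, Real.exp_zero, mul_one]
    _ ≤ 2 ^ t * (C * (h ^ n * (n ! : ℝ) ^ s)) * Real.exp (-(r * ‖x‖ ^ t⁻¹)) := by gcongr
    _ = _ := by ring

lemma GSSpace.exists_gevreyDecay (ht : 0 < t) (hs : 0 < s) (f : GSSpace d t s) {h r : ℝ}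
    (hh : 0 < h) (hr : 0 < r) : ∃ C : ℝ, GevreyDecay t s h r C f.toFun :=
  (normEstimates_of_bddAbove ht hs f.contDiff fun _ hh => f.bddAbove hh).exists_gevreyDecay
    f.contDiff ht hh hr

lemma factorial_sum_rpow_le (hs : 0 ≤ s) (α : Fin d → ℕ) :
    ((∑ i, α i)! : ℝ) ^ s ≤ (((d : ℝ) + 1) ^ s) ^ (∑ i, α i) * multiFactorial α ^ s := by
  have hα := multiFactorial_pos α
  calc ((∑ i, α i)! : ℝ) ^ s ≤ (((d : ℝ) + 1) ^ (∑ i, α i) * multiFactorial α) ^ s := by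
        refine Real.rpow_le_rpow (by positivity) ((factorial_sum_le α).trans ?_) hs
        gcongr
        exact le_add_of_nonneg_right zero_le_one
    _ = _ := by
        rw [Real.mul_rpow (by positivity) hα.le, Real.rpow_pow_comm (by positivity)]

lemma gsQuotient_le_of_gevreyDecay (ht : 0 < t) (hs : 0 < s) {h C : ℝ} (hh : 0 < h)
    {f : RSpace d → ℂ} (H : GevreyDecay t s (h / ((d : ℝ) + 1) ^ s)
      (t / (h / ((d : ℝ) + 1) ^ t) ^ t⁻¹) C f)
    (p : (Fin d → ℕ) × (Fin d → ℕ) × RSpace d) : gsQuotient t s h f p ≤ C := by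
  obtain ⟨α, β, x⟩ := p
  set D : ℝ := (d : ℝ) + 1
  have hD : 0 < D := by positivity
  set k := ∑ i, α i
  set n := ∑ i, β i
  set E : ℝ := Real.exp (t * (‖x‖ / (h / D ^ t)) ^ t⁻¹) with hE
  have hE0 : 0 < E := Real.exp_pos _
  have hC := H.nonneg
  have hα := multiFactorial_pos α
  have hderiv : ‖iteratedFDeriv ℝ n f x‖ ≤ C * E⁻¹ * ((h / D ^ s) ^ n * (n ! : ℝ) ^ s) := by
    convert H.boundAt x n using 3
    rw [hE, ← Real.exp_neg, Real.div_rpow (norm_nonneg x) (by positivity)]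
    ring_nf
  rw [gsQuotient, div_le_iff₀ (gsDenom_pos hh _)]
  simp only [norm_mul, Complex.norm_real, Real.norm_eq_abs, Finset.sum_add_distrib]
  calc |monom α x| * ‖multiDeriv β f x‖ ≤ ‖x‖ ^ k * ‖iteratedFDeriv ℝ n f x‖ :=
        mul_le_mul (abs_monom_le α x) (norm_multiDeriv_le β H.contDiff x) (norm_nonneg _)
          (by positivity)
    _ ≤ E * ((h / D ^ t) ^ k * (k ! : ℝ) ^ t) *
          (C * E⁻¹ * ((h / D ^ s) ^ n * (n ! : ℝ) ^ s)) :=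
        mul_le_mul (pow_le_exp_mul_factorial_rpow ht (by positivity) (norm_nonneg x) k) hderiv
          (norm_nonneg _) (by positivity)
    _ ≤ E * ((h / D ^ t) ^ k * ((D ^ t) ^ k * multiFactorial α ^ t)) *
          (C * E⁻¹ * ((h / D ^ s) ^ n * ((D ^ s) ^ n * multiFactorial β ^ s))) := by
        gcongr
        · exact factorial_sum_rpow_le ht.le α
        · exact factorial_sum_rpow_le hs.le β
    _ = C * (h ^ (k + n) * multiFactorial α ^ t * multiFactorial β ^ s) := by
        rw [div_pow, div_pow, pow_add]
        field_simp

lemma exists_gsSeminorm_le_of_gevreyDecay (ht : 0 < t) (hs : 0 < s) (h : Set.Ioi (0 : ℝ)) :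
    ∃ g r : ℝ, 0 < g ∧ 0 < r ∧ ∀ (C : ℝ) (f : GSSpace d t s),
      GevreyDecay t s g r C f.toFun → gsSeminorm d t s h f ≤ C := by
  have hh : 0 < (h : ℝ) := h.2
  exact ⟨h / ((d : ℝ) + 1) ^ s, t / (h / ((d : ℝ) + 1) ^ t) ^ t⁻¹, by positivity, by positivity,
    fun _ _ H => ciSup_le fun p => gsQuotient_le_of_gevreyDecay ht hs hh H p⟩

end GelfandShilovEstimates

section TimeFrequencyShifts

open scoped ContDiff Nat

variable {t s h r C : ℝ}

lemma exp_neg_norm_rpow_le {E : Type*} [SeminormedAddCommGroup E] (ht : 0 < t) (hr : 0 ≤ r)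
    (x y : E) : Real.exp (-(r * 2 ^ t⁻¹ * ‖y‖ ^ t⁻¹)) ≤
      Real.exp (r * 2 ^ t⁻¹ * ‖y - x‖ ^ t⁻¹) * Real.exp (-(r * ‖x‖ ^ t⁻¹)) := by
  rw [← Real.exp_add, Real.exp_le_exp]
  have hx : ‖x‖ ^ t⁻¹ ≤ 2 ^ t⁻¹ * (‖y - x‖ ^ t⁻¹ + ‖y‖ ^ t⁻¹) := by
    simpa [norm_sub_rev] using norm_add_rpow_inv_le ht (x - y) y
  nlinarith [mul_le_mul_of_nonneg_left hx hr]

lemma GevreyDecay.comp_sub {E F : Type*} [NormedAddCommGroup E] [NormedSpace ℝ E]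
    [NormedAddCommGroup F] [NormedSpace ℝ F] {f : E → F} (ht : 0 < t) (hh : 0 ≤ h) (hr : 0 ≤ r)
    (H : GevreyDecay t s h (r * 2 ^ t⁻¹) C f) (a : E) :
    GevreyDecay t s h r (C * Real.exp (r * 2 ^ t⁻¹ * ‖a‖ ^ t⁻¹)) fun y => f (y - a) := by
  refine ⟨H.contDiff.comp (contDiff_id.sub contDiff_const), fun x n => ?_⟩
  rw [iteratedFDeriv_comp_sub]
  refine (H.boundAt (x - a)).mono hh ?_ n
  rw [mul_assoc C]
  refine mul_le_mul_of_nonneg_left ?_ H.nonneg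
  simpa using exp_neg_norm_rpow_le ht hr x (x - a)

lemma gevreyBoundAt_character (hs : 0 < s) (hh : 0 < h) (ξ x : RSpace d) :
    GevreyBoundAt s h (Real.exp (s * (‖ξ‖ / h) ^ s⁻¹)) (character ξ) x := fun n =>
  (norm_iteratedFDeriv_character_le ξ n x).trans
    (pow_le_exp_mul_factorial_rpow hs hh (norm_nonneg ξ) n)

lemma GevreyDecay.character_mul {f : RSpace d → ℂ} (hs : 0 < s) (hh : 0 < h)
    (H : GevreyDecay t s h r C f) (ξ : RSpace d) :
    GevreyDecay t s (2 * h) r (Real.exp (s * (‖ξ‖ / h) ^ s⁻¹) * C)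
      fun y => character ξ y * f y :=
  ⟨(contDiff_character ξ).mul H.contDiff, fun x => by
    rw [mul_assoc]
    exact (gevreyBoundAt_character hs hh ξ x).mul hs.le hh.le (contDiff_character ξ) H.contDiff
      (H.boundAt x)⟩

lemma GevreyDecay.timeFreqShift {f : RSpace d → ℂ} (ht : 0 < t) (hs : 0 < s) (hh : 0 < h)
    (hr : 0 ≤ r) (H : GevreyDecay t s (h / 2) (r * 2 ^ t⁻¹) C f) (x ξ : RSpace d) :
    GevreyDecay t s h r
      (C * Real.exp (r * 2 ^ t⁻¹ * ‖x‖ ^ t⁻¹ + s * (‖ξ‖ / (h / 2)) ^ s⁻¹))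
      fun y => character ξ y * f (y - x) := by
  have hxξ := (H.comp_sub ht (by positivity) hr x).character_mul hs (by positivity) ξ
  rw [mul_div_cancel₀ h two_ne_zero] at hxξ
  convert hxξ using 1
  rw [Real.exp_add]
  ring

end TimeFrequencyShifts

section ConvergenceToZero

open scoped ContDiff Nat Topology
open Filter

variable {ι : Type*} {l : Filter ι} {t s : ℝ}

/-- Convergence to zero of a family of functions in the topology of `Σ_t^s`, expressed by
`GevreyDecay` estimates whose constants tend to zero. -/
def GevreyTendstoZero (t s : ℝ) (l : Filter ι) (F : ι → RSpace d → ℂ) : Prop :=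
  ∀ ⦃h r ε : ℝ⦄, 0 < h → 0 < r → 0 < ε → ∀ᶠ i in l, GevreyDecay t s h r ε (F i)

namespace GevreyTendstoZero

lemma add {F G : ι → RSpace d → ℂ} (HF : GevreyTendstoZero t s l F)
    (HG : GevreyTendstoZero t s l G) : GevreyTendstoZero t s l fun i => F i + G i := by
  intro h r ε hh hr hε
  filter_upwards [HF hh hr (half_pos hε), HG hh hr (half_pos hε)] with i hF hG
  simpa using hF.add hG

lemma timeFreqShift {F : ι → RSpace d → ℂ} (H : GevreyTendstoZero t s l F) (ht : 0 < t)
    (hs : 0 < s) {x ξ : ι → RSpace d} (hx : l.IsBoundedUnder (· ≤ ·) fun i => ‖x i‖)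
    (hξ : l.IsBoundedUnder (· ≤ ·) fun i => ‖ξ i‖) :
    GevreyTendstoZero t s l fun i y => character (ξ i) y * F i (y - x i) := by
  intro h r ε hh hr hε
  obtain ⟨R, hR⟩ := hx
  obtain ⟨S, hS⟩ := hξ
  set M : ℝ := r * 2 ^ t⁻¹ * R ^ t⁻¹ + s * (S / (h / 2)) ^ s⁻¹
  filter_upwards [H (half_pos hh) (by positivity : 0 < r * 2 ^ t⁻¹)
    (by positivity : 0 < ε * Real.exp (-M)),
    eventually_map.1 hR, eventually_map.1 hS] with i hF hxR hξS
  refine (hF.timeFreqShift ht hs hh hr.le (x i) (ξ i)).mono hh.le ?_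
  have hM : r * 2 ^ t⁻¹ * ‖x i‖ ^ t⁻¹ + s * (‖ξ i‖ / (h / 2)) ^ s⁻¹ ≤ M := by
    have := (inv_pos.2 ht).le
    have := (inv_pos.2 hs).le
    dsimp only [M]
    gcongr
  calc ε * Real.exp (-M) *
        Real.exp (r * 2 ^ t⁻¹ * ‖x i‖ ^ t⁻¹ + s * (‖ξ i‖ / (h / 2)) ^ s⁻¹)
      ≤ ε * Real.exp (-M) * Real.exp M := by gcongr
    _ = ε := by rw [mul_assoc, ← Real.exp_add, neg_add_cancel, Real.exp_zero, mul_one]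

end GevreyTendstoZero

lemma withSeminorms_gsSeminorm (d : ℕ) (t s : ℝ) :
    WithSeminorms (show SeminormFamily ℂ (GSSpace d t s) (Set.Ioi (0 : ℝ)) from
      gsSeminorm d t s) := ⟨rfl⟩

instance : IsTopologicalAddGroup (GSSpace d t s) :=
  (withSeminorms_gsSeminorm d t s).topologicalAddGroup

instance : ContinuousSMul ℂ (GSSpace d t s) :=
  (withSeminorms_gsSeminorm d t s).continuousSMul

lemma tendsto_of_gevreyTendstoZero (ht : 0 < t) (hs : 0 < s) {F : ι → GSSpace d t s}
    {f : GSSpace d t s} (H : GevreyTendstoZero t s l fun i => (F i - f).toFun) :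
    Tendsto F l (𝓝 f) := by
  refine ((withSeminorms_gsSeminorm d t s).tendsto_nhds _ _).2 fun h ε hε => ?_
  obtain ⟨g, r, hg, hr, hgr⟩ := exists_gsSeminorm_le_of_gevreyDecay (d := d) ht hs h
  filter_upwards [H hg hr (half_pos hε)] with i hi
  exact (hgr _ _ hi).trans_lt (half_lt_self hε)

lemma GevreyDecay.fderiv {E F : Type*} [NormedAddCommGroup E] [NormedSpace ℝ E]
    [NormedAddCommGroup F] [NormedSpace ℝ F] {f : E → F} {h r C K : ℝ} (hh : 0 ≤ h)
    (hK : ∀ n : ℕ, ((n : ℝ) + 1) ^ s ≤ K * 2 ^ n) (H : GevreyDecay t s h r C f) :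
    GevreyDecay t s (2 * h) r (C * h * K) (fderiv ℝ f) := by
  refine ⟨H.contDiff.fderiv_right (mod_cast le_top), fun x n => ?_⟩
  have hC := H.nonneg
  calc ‖iteratedFDeriv ℝ n (_root_.fderiv ℝ f) x‖ = ‖iteratedFDeriv ℝ (n + 1) f x‖ :=
        norm_iteratedFDeriv_fderiv
    _ ≤ C * Real.exp (-(r * ‖x‖ ^ t⁻¹)) * (h ^ (n + 1) * ((n + 1)! : ℝ) ^ s) :=
        H.boundAt x (n + 1)
    _ = C * h * ((n : ℝ) + 1) ^ s * Real.exp (-(r * ‖x‖ ^ t⁻¹)) * (h ^ n * (n ! : ℝ) ^ s) := by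
        rw [Nat.factorial_succ, Nat.cast_mul, Real.mul_rpow (by positivity) (by positivity)]
        push_cast
        ring
    _ ≤ C * h * (K * 2 ^ n) * Real.exp (-(r * ‖x‖ ^ t⁻¹)) * (h ^ n * (n ! : ℝ) ^ s) := by
        gcongr
        exact hK n
    _ = _ := by ring

lemma GevreyDecay.comp_sub_sub {E F : Type*} [NormedAddCommGroup E] [NormedSpace ℝ E]
    [NormedAddCommGroup F] [NormedSpace ℝ F] {f : E → F} {h r C : ℝ} (ht : 0 < t) (hh : 0 ≤ h)
    (hr : 0 ≤ r) (hf : ContDiff ℝ ∞ f)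
    (H : GevreyDecay t s h (r * 2 ^ t⁻¹) C (_root_.fderiv ℝ f)) (a : E) :
    GevreyDecay t s h r (C * Real.exp (r * 2 ^ t⁻¹ * ‖a‖ ^ t⁻¹) * ‖a‖)
      fun y => f (y - a) - f y := by
  have hfa : ContDiff ℝ ∞ fun y => f (y - a) := hf.comp (contDiff_id.sub contDiff_const)
  refine ⟨hfa.sub hf, fun x n => ?_⟩
  have hC := H.nonneg
  have hderiv : ∀ z ∈ segment ℝ x (x - a), ‖_root_.fderiv ℝ (iteratedFDeriv ℝ n f) z‖ ≤
      C * (Real.exp (r * 2 ^ t⁻¹ * ‖a‖ ^ t⁻¹) * Real.exp (-(r * ‖x‖ ^ t⁻¹))) *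
        (h ^ n * (n ! : ℝ) ^ s) := by
    intro z hz
    have hza : ‖z - x‖ ≤ ‖a‖ := by
      simpa using norm_sub_le_of_mem_segment hz
    rw [norm_fderiv_iteratedFDeriv, ← norm_iteratedFDeriv_fderiv]
    refine (H.boundAt z).mono hh ?_ n
    refine mul_le_mul_of_nonneg_left ((exp_neg_norm_rpow_le ht hr x z).trans ?_) hC
    have := (inv_pos.2 ht).le
    gcongr
  have hdiff : iteratedFDeriv ℝ n (fun y => f (y - a) - f y) x =
      iteratedFDeriv ℝ n f (x - a) - iteratedFDeriv ℝ n f x := by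
    rw [← iteratedFDeriv_comp_sub n a x]
    exact iteratedFDeriv_sub_apply (hfa.of_le (mod_cast le_top)).contDiffAt
      (hf.of_le (mod_cast le_top)).contDiffAt
  have hmean := (convex_segment x (x - a)).norm_image_sub_le_of_norm_fderiv_le (𝕜 := ℝ)
    (fun z _ => hf.differentiable_iteratedFDeriv (m := n)
      (WithTop.coe_lt_coe.2 (ENat.natCast_lt_top _)) z) hderiv
    (left_mem_segment ℝ _ _) (right_mem_segment ℝ _ _)
  rw [hdiff]
  refine hmean.trans_eq ?_
  rw [sub_sub_cancel_left, norm_neg]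
  ring

lemma gevreyTendstoZero_comp_sub_sub (ht : 0 < t) (hs : 0 < s) (f : GSSpace d t s) :
    GevreyTendstoZero t s (𝓝 0) fun a y => f.toFun (y - a) - f.toFun y := by
  intro h r ε hh hr hε
  obtain ⟨K, -, hK⟩ := exists_succ_rpow_le hs
  obtain ⟨C, hC⟩ := f.exists_gevreyDecay ht hs (half_pos hh) (by positivity : 0 < r * 2 ^ t⁻¹)
  have hderiv := hC.fderiv (by positivity) hK
  rw [mul_div_cancel₀ h two_ne_zero] at hderiv
  have hlim : Tendsto (fun a : RSpace d =>
      C * (h / 2) * K * Real.exp (r * 2 ^ t⁻¹ * ‖a‖ ^ t⁻¹) * ‖a‖) (𝓝 0) (𝓝 0) := by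
    have hcont : Continuous fun a : RSpace d => ‖a‖ ^ t⁻¹ := continuous_norm_rpow_inv ht
    exact Continuous.tendsto' (by fun_prop) _ _ (by simp)
  filter_upwards [hlim.eventually (gt_mem_nhds hε)] with a ha
  exact (hderiv.comp_sub_sub ht hh.le hr.le f.contDiff a).mono hh.le ha.le

lemma norm_iteratedFDeriv_character_sub_one_le (ξ x : RSpace d) (hξ : ‖ξ‖ ≤ 1) (n : ℕ) :
    ‖iteratedFDeriv ℝ n (fun y => character ξ y - 1) x‖ ≤ ‖ξ‖ * (1 + ‖x‖) := by
  rcases n with _ | n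
  · have hexp : ‖character ξ x - 1‖ ≤ ‖(inner ℝ x ξ : ℝ)‖ := by
      simpa [character] using Real.norm_exp_I_mul_ofReal_sub_one_le (x := inner ℝ x ξ)
    rw [norm_iteratedFDeriv_zero]
    linarith [hexp.trans (norm_inner_le_norm x ξ), norm_nonneg ξ]
  · have hconst : iteratedFDeriv ℝ (n + 1) (fun y => character ξ y - 1) x =
        iteratedFDeriv ℝ (n + 1) (character ξ) x := by
      have hsub := iteratedFDeriv_sub_apply (i := n + 1) (x := x)
        ((contDiff_character ξ).of_le (mod_cast le_top)).contDiffAt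
        (contDiff_const (c := (1 : ℂ))).contDiffAt
      rwa [iteratedFDeriv_const_of_ne n.succ_ne_zero, Pi.zero_apply, sub_zero] at hsub
    rw [hconst]
    refine (norm_iteratedFDeriv_character_le ξ (n + 1) x).trans ?_
    rw [pow_succ']
    gcongr
    exact (pow_le_one₀ (norm_nonneg _) hξ).trans (le_add_of_nonneg_right (norm_nonneg _))

lemma gevreyBoundAt_character_sub_one {h : ℝ} (hs : 0 < s) (hh : 0 < h) {ξ : RSpace d}
    (hξ : ‖ξ‖ ≤ 1) (x : RSpace d) :
    GevreyBoundAt s h (‖ξ‖ * (1 + ‖x‖) * Real.exp (s * (1 / h) ^ s⁻¹))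
      (fun y => character ξ y - 1) x := fun n => by
  refine (norm_iteratedFDeriv_character_sub_one_le ξ x hξ n).trans ?_
  rw [mul_assoc]
  refine le_mul_of_one_le_right (by positivity) ?_
  simpa using pow_le_exp_mul_factorial_rpow hs hh zero_le_one n

lemma gevreyTendstoZero_character_sub_one_mul (ht : 0 < t) (hs : 0 < s) (f : GSSpace d t s) :
    GevreyTendstoZero t s (𝓝 0) fun ξ y => (character ξ y - 1) * f.toFun y := by
  intro h r ε hh hr hε
  obtain ⟨K, _, hK⟩ := exists_pow_le_exp_rpow_inv ht 1
  obtain ⟨C, hC⟩ := f.exists_gevreyDecay ht hs (half_pos hh) (by positivity : 0 < r + 1)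
  set A : ℝ := Real.exp (s * (1 / (h / 2)) ^ s⁻¹)
  have hlim : Tendsto (fun ξ : RSpace d => ‖ξ‖ * ((1 + K) * A * C)) (𝓝 0) (𝓝 0) :=
    Continuous.tendsto' (by fun_prop) _ _ (by simp)
  have hball : ∀ᶠ ξ : RSpace d in 𝓝 0, ‖ξ‖ < 1 :=
    (continuous_norm.tendsto' (0 : RSpace d) 0 norm_zero).eventually (gt_mem_nhds one_pos)
  filter_upwards [hlim.eventually (gt_mem_nhds hε), hball] with ξ hξε hξ
  have hsmooth : ContDiff ℝ ∞ fun y => character ξ y - 1 :=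
    (contDiff_character ξ).sub contDiff_const
  refine ⟨hsmooth.mul f.contDiff, fun x => ?_⟩
  have hC0 := hC.nonneg
  have hmul := (gevreyBoundAt_character_sub_one hs (half_pos hh) hξ.le x).mul hs.le (by positivity)
    hsmooth f.contDiff (hC.boundAt x)
  rw [mul_div_cancel₀ h two_ne_zero] at hmul
  refine hmul.mono hh.le ?_
  have hx : 1 + ‖x‖ ≤ (1 + K) * Real.exp (‖x‖ ^ t⁻¹) := by
    have hone : 1 ≤ Real.exp (‖x‖ ^ t⁻¹) := Real.one_le_exp (by positivity)
    linarith [(pow_one ‖x‖).symm.trans_le (hK ‖x‖ (norm_nonneg x))]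
  calc ‖ξ‖ * (1 + ‖x‖) * A * (C * Real.exp (-((r + 1) * ‖x‖ ^ t⁻¹)))
      ≤ ‖ξ‖ * ((1 + K) * Real.exp (‖x‖ ^ t⁻¹)) * A *
          (C * Real.exp (-((r + 1) * ‖x‖ ^ t⁻¹))) := by gcongr
    _ = ‖ξ‖ * ((1 + K) * A * C) *
          (Real.exp (‖x‖ ^ t⁻¹) * Real.exp (-((r + 1) * ‖x‖ ^ t⁻¹))) := by ring
    _ = ‖ξ‖ * ((1 + K) * A * C) * Real.exp (-(r * ‖x‖ ^ t⁻¹)) := by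
        rw [← Real.exp_add]
        ring_nf
    _ ≤ ε * Real.exp (-(r * ‖x‖ ^ t⁻¹)) := by gcongr

lemma character_add (ξ η y : RSpace d) :
    character (ξ + η) y = character ξ y * character η y := by
  rw [character, character, character, ← Complex.exp_add, inner_add_right]
  push_cast
  ring_nf

lemma continuous_timeFreqShift (ht : 0 < t) (hs : 0 < s) (ψ : GSSpace d t s) :
    Continuous fun z : PhaseSpace d => timeFreqShift ht hs z.1 z.2 ψ := by
  refine continuous_iff_continuousAt.2 fun w => tendsto_of_gevreyTendstoZero ht hs ?_
  have hx : Tendsto (fun z : PhaseSpace d => z.1 - w.1) (𝓝 w) (𝓝 0) :=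
    Continuous.tendsto' (by fun_prop) _ _ (sub_self _)
  have hξ : Tendsto (fun z : PhaseSpace d => z.2 - w.2) (𝓝 w) (𝓝 0) :=
    Continuous.tendsto' (by fun_prop) _ _ (sub_self _)
  have htranslate : GevreyTendstoZero t s (𝓝 w) fun z y =>
      ψ.toFun (y - (z.1 - w.1)) - ψ.toFun y := fun _ _ _ hh hr hε =>
    hx.eventually (gevreyTendstoZero_comp_sub_sub ht hs ψ hh hr hε)
  have hmodulate : GevreyTendstoZero t s (𝓝 w) fun z y =>
      (character (z.2 - w.2) y - 1) * (timeFreqShift ht hs w.1 w.2 ψ).toFun y :=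
    fun _ _ _ hh hr hε => hξ.eventually (gevreyTendstoZero_character_sub_one_mul ht hs _ hh hr hε)
  convert (htranslate.timeFreqShift ht hs (x := fun _ => w.1) (ξ := Prod.snd)
    isBoundedUnder_const (continuous_snd.tendsto w).norm.isBoundedUnder_le).add hmodulate using 1
  funext z y
  change character z.2 y * ψ.toFun (y - z.1) - character w.2 y * ψ.toFun (y - w.1) =
    character z.2 y * (ψ.toFun (y - w.1 - (z.1 - w.1)) - ψ.toFun (y - w.1)) +
      (character (z.2 - w.2) y - 1) * (character w.2 y * ψ.toFun (y - w.1))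
  rw [sub_sub_sub_cancel_right, ← sub_add_cancel z.2 w.2, character_add, add_sub_cancel_right]
  ring

end ConvergenceToZero

section PhaseWeight

variable {t s : ℝ}

/-- The weight `‖x‖^{1/t} + ‖ξ‖^{1/s}` on phase space, homogeneous of degree one for the
dilations `(x, ξ) ↦ (λ^t x, λ^s ξ)`. -/
def phaseWeight (t s : ℝ) (z : PhaseSpace d) : ℝ := ‖z.1‖ ^ t⁻¹ + ‖z.2‖ ^ s⁻¹

lemma phaseWeight_nonneg (t s : ℝ) (z : PhaseSpace d) : 0 ≤ phaseWeight t s z := by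
  unfold phaseWeight
  positivity

lemma continuous_phaseWeight (ht : 0 < t) (hs : 0 < s) :
    Continuous (phaseWeight (d := d) t s) :=
  ((continuous_norm_rpow_inv ht).comp continuous_fst).add
    ((continuous_norm_rpow_inv hs).comp continuous_snd)

lemma exists_phaseWeight_add_le (ht : 0 < t) (hs : 0 < s) :
    ∃ K : ℝ, 0 < K ∧ ∀ z w : PhaseSpace d,
      phaseWeight t s (z + w) ≤ K * (phaseWeight t s z + phaseWeight t s w) := by
  refine ⟨2 ^ t⁻¹ + 2 ^ s⁻¹, by positivity, fun z w => ?_⟩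
  have hfst := norm_add_rpow_inv_le ht z.1 w.1
  have hsnd := norm_add_rpow_inv_le hs z.2 w.2
  have : 0 ≤ (2 : ℝ) ^ t⁻¹ * (‖z.2‖ ^ s⁻¹ + ‖w.2‖ ^ s⁻¹) := by positivity
  have : 0 ≤ (2 : ℝ) ^ s⁻¹ * (‖z.1‖ ^ t⁻¹ + ‖w.1‖ ^ t⁻¹) := by positivity
  simp only [phaseWeight, Prod.fst_add, Prod.snd_add]
  linarith

lemma exists_gsSeminorm_timeFreqShift_le (ht : 0 < t) (hs : 0 < s) (h : Set.Ioi (0 : ℝ))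
    (ψ : GSSpace d t s) : ∃ C r : ℝ, 0 ≤ C ∧ 0 < r ∧ ∀ z : PhaseSpace d,
      gsSeminorm d t s h (timeFreqShift ht hs z.1 z.2 ψ) ≤
        C * Real.exp (r * phaseWeight t s z) := by
  obtain ⟨g, r, hg, hr, hgr⟩ := exists_gsSeminorm_le_of_gevreyDecay (d := d) ht hs h
  obtain ⟨C, hC⟩ := ψ.exists_gevreyDecay ht hs (half_pos hg) (by positivity : 0 < r * 2 ^ t⁻¹)
  refine ⟨C, r * 2 ^ t⁻¹ + s / (g / 2) ^ s⁻¹, hC.nonneg, by positivity, fun z =>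
    (hgr _ _ (hC.timeFreqShift ht hs hg hr.le z.1 z.2)).trans ?_⟩
  have hC0 := hC.nonneg
  have : 0 ≤ r * 2 ^ t⁻¹ * ‖z.2‖ ^ s⁻¹ := by positivity
  have : 0 ≤ s / (g / 2) ^ s⁻¹ * ‖z.1‖ ^ t⁻¹ := by positivity
  rw [Real.div_rpow (norm_nonneg _) (by positivity), mul_div_left_comm, mul_comm (‖z.2‖ ^ s⁻¹)]
  gcongr
  unfold phaseWeight
  linarith

end PhaseWeight

section Functionals

open scoped ContDiff Nat Topology ENNReal
open MeasureTheory

lemma exists_strongDual_apply_eq {𝕜 V B : Type*} [RCLike 𝕜] [AddCommGroup V] [Module 𝕜 V]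
    [NormedAddCommGroup B] [NormedSpace 𝕜 B] (J : V →ₗ[𝕜] B) (v : V →ₗ[𝕜] 𝕜) {C : ℝ}
    (hv : ∀ f, ‖v f‖ ≤ C * ‖J f‖) : ∃ L : StrongDual 𝕜 B, ∀ f, L (J f) = v f := by
  have hker : LinearMap.ker J ≤ LinearMap.ker v := fun f hf => by
    simpa [LinearMap.mem_ker.1 hf] using hv f
  set w : LinearMap.range J →ₗ[𝕜] 𝕜 :=
    (LinearMap.ker J).liftQ v hker ∘ₗ J.quotKerEquivRange.symm.toLinearMap
  have hw (f : V) : w ⟨J f, LinearMap.mem_range_self J f⟩ = v f := by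
    have := J.quotKerEquivRange_symm_apply_image f (LinearMap.mem_range_self J f)
    simp [w, this]
  obtain ⟨L, hL, -⟩ := exists_extension_norm_eq _ (w.mkContinuous C (by
    rintro ⟨_, f, rfl⟩
    rw [hw]
    exact hv f))
  exact ⟨L, fun f => (hL ⟨J f, f, rfl⟩).trans (hw f)⟩

variable {t s : ℝ}

lemma gsSeminorm_antitone (d : ℕ) (t s : ℝ) : Antitone (gsSeminorm d t s) := by
  intro h h' hle f
  refine ciSup_le fun p => le_trans ?_ (le_ciSup (f.bddAbove h.2) p)
  have h0 : 0 < (h : ℝ) := h.2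
  have := multiFactorial_pos p.1
  have := multiFactorial_pos p.2.1
  refine div_le_div_of_nonneg_left (norm_nonneg _) (gsDenom_pos h0 p) ?_
  gcongr

lemma GSDual.exists_norm_le_gsSeminorm (u : GSDual d t s) :
    ∃ (h : Set.Ioi (0 : ℝ)) (C : ℝ), 0 ≤ C ∧ ∀ f, ‖u f‖ ≤ C * gsSeminorm d t s h f := by
  obtain ⟨S, C, -, hC⟩ := Seminorm.bound_of_continuous (withSeminorms_gsSeminorm d t s)
    ((normSeminorm ℂ ℂ).comp u.toLinearMap) u.continuous.norm
  obtain ⟨h, hh⟩ : BddBelow (S : Set (Set.Ioi (0 : ℝ))) := S.bddBelow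
  refine ⟨h, C, C.2, fun f => (hC f).trans (mul_le_mul_of_nonneg_left ?_ C.2)⟩
  exact Finset.sup_le (fun i hi => gsSeminorm_antitone d t s (hh hi)) f

/-- The normalized quantity `x^α ∂^β f(x) / (h^{|α+β|} α!^t β!^s)` at `p = (α, β, x)`, whose
supremum over `p` is `‖f‖_h`. -/
def gsCoordinate (t s h : ℝ) (f : RSpace d → ℂ)
    (p : (Fin d → ℕ) × (Fin d → ℕ) × RSpace d) : ℂ :=
  (monom p.1 p.2.2 : ℂ) * multiDeriv p.2.1 f p.2.2 /
    ((h ^ (∑ i, (p.1 i + p.2.1 i)) * multiFactorial p.1 ^ t * multiFactorial p.2.1 ^ s : ℝ) : ℂ)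

lemma norm_gsCoordinate {h : ℝ} (hh : 0 < h) (f : RSpace d → ℂ)
    (p : (Fin d → ℕ) × (Fin d → ℕ) × RSpace d) :
    ‖gsCoordinate t s h f p‖ = gsQuotient t s h f p := by
  rw [gsCoordinate, gsQuotient, norm_div, Complex.norm_real,
    Real.norm_of_nonneg (gsDenom_pos hh p).le]

/-- The embedding of `Σ_t^s(ℝ^d)` into a Banach space of bounded families that turns
`gsSeminorm d t s h` into the supremum norm. -/
def gsEmbedding (d : ℕ) (t s : ℝ) (h : Set.Ioi (0 : ℝ)) :
    GSSpace d t s →ₗ[ℂ] lp (fun _ : (Fin d → ℕ) × (Fin d → ℕ) × RSpace d => ℂ) ∞ where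
  toFun f := ⟨gsCoordinate t s h f.toFun, memℓp_infty_iff.2 (by
    simpa only [norm_gsCoordinate h.2] using f.bddAbove h.2)⟩
  map_add' f g := by
    ext p
    change gsCoordinate t s h (f.toFun + g.toFun) p =
      gsCoordinate t s h f.toFun p + gsCoordinate t s h g.toFun p
    rw [gsCoordinate, multiDeriv_add _ f.contDiff g.contDiff, Pi.add_apply, mul_add, add_div]
    rfl
  map_smul' c f := by
    ext p
    change gsCoordinate t s h (c • f.toFun) p = c * gsCoordinate t s h f.toFun p
    rw [gsCoordinate, multiDeriv_smul _ c f.contDiff, Pi.smul_apply, smul_eq_mul,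
      mul_left_comm, mul_div_assoc]
    rfl

lemma norm_gsEmbedding (h : Set.Ioi (0 : ℝ)) (f : GSSpace d t s) :
    ‖gsEmbedding d t s h f‖ = gsSeminorm d t s h f := by
  rw [lp.norm_eq_ciSup]
  exact iSup_congr fun p => norm_gsCoordinate h.2 f.toFun p

lemma continuous_gsEmbedding (h : Set.Ioi (0 : ℝ)) : Continuous (gsEmbedding d t s h) :=
  (withSeminorms_gsSeminorm d t s).continuous_normedSpace_rng _ _
    ⟨{h}, 1, fun f => by simp [norm_gsEmbedding]⟩

lemma listDeriv_eq_multiDeriv_count (l : List (Fin d)) {f : RSpace d → ℂ}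
    (hf : ContDiff ℝ ∞ f) : listDeriv l f = multiDeriv (fun i => l.count i) f := by
  funext x
  have := multiDeriv_count l.get hf x
  rw [List.ofFn_get] at this
  rw [← this]
  exact listDeriv_eq_iteratedFDeriv l hf x

lemma exists_strongDual_gsEmbedding_eq_listDeriv (t s : ℝ) (h : Set.Ioi (0 : ℝ))
    (l : List (Fin d)) : ∃ C : ℝ, ∀ x : RSpace d,
      ∃ L : StrongDual ℂ (lp (fun _ : (Fin d → ℕ) × (Fin d → ℕ) × RSpace d => ℂ) ∞),
        ‖L‖ ≤ C ∧ ∀ f, L (gsEmbedding d t s h f) = listDeriv l f.toFun x := by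
  set β : Fin d → ℕ := fun i => l.count i
  set c : ℝ := (h : ℝ) ^ (∑ i, β i) * multiFactorial β ^ s with hc
  have hh : 0 < (h : ℝ) := h.2
  have hβ := multiFactorial_pos β
  have hc0 : 0 < c := by positivity
  refine ⟨‖(c : ℂ)‖, fun x => ⟨(c : ℂ) • lp.evalCLM ℂ
    (fun _ : (Fin d → ℕ) × (Fin d → ℕ) × RSpace d => ℂ) ∞ (0, β, x), ?_, fun f => ?_⟩⟩
  · rw [norm_smul]
    refine mul_le_of_le_one_right (norm_nonneg _) ?_
    exact LinearMap.mkContinuous_norm_le _ zero_le_one _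
  · change (c : ℂ) * gsCoordinate t s h f.toFun (0, β, x) = _
    rw [listDeriv_eq_multiDeriv_count l f.contDiff, gsCoordinate]
    have hcoord : (monom (0 : Fin d → ℕ) x : ℂ) = 1 := by simp [monom]
    have hdenom : (h : ℝ) ^ (∑ i, ((0 : Fin d → ℕ) i + β i)) *
        multiFactorial (0 : Fin d → ℕ) ^ t * multiFactorial β ^ s = c := by
      simp [multiFactorial, hc]
    rw [hcoord, hdenom, one_mul, mul_div_cancel₀ _ (Complex.ofReal_ne_zero.2 hc0.ne')]

lemma hasDerivAt_listDeriv_line (l : List (Fin d)) (i : Fin d) (f : GSSpace d t s) (x : RSpace d)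
    (τ : ℝ) : HasDerivAt (fun τ : ℝ => listDeriv l f.toFun (x + τ • EuclideanSpace.single i 1))
      (listDeriv (i :: l) f.toFun (x + τ • EuclideanSpace.single i 1)) τ := by
  have hderiv := ((contDiff_listDeriv l f.contDiff).differentiable (by simp)
    (x + τ • EuclideanSpace.single i 1)).hasFDerivAt
  have hline : HasDerivAt (fun τ : ℝ => x + τ • EuclideanSpace.single i 1)
      (EuclideanSpace.single i (1 : ℝ)) τ := by
    simpa using ((hasDerivAt_id τ).smul_const (EuclideanSpace.single i (1 : ℝ))).const_add x
  exact hderiv.comp_hasDerivAt τ hline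

section Integral

variable {W : Type*} [MeasurableSpace W] {μ : Measure W} {G : W → GSSpace d t s}
  {F : GSSpace d t s} {h : Set.Ioi (0 : ℝ)}

lemma listDeriv_eq_integral (hG : Integrable (fun w => gsEmbedding d t s h (G w)) μ)
    (hF : ∀ x, F.toFun x = ∫ w, (G w).toFun x ∂μ) (l : List (Fin d)) (x : RSpace d) :
    listDeriv l F.toFun x = ∫ w, listDeriv l (G w).toFun x ∂μ := by
  have hint (l : List (Fin d)) (x : RSpace d) :
      Integrable (fun w => listDeriv l (G w).toFun x) μ := by
    obtain ⟨C, hC⟩ := exists_strongDual_gsEmbedding_eq_listDeriv t s h l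
    obtain ⟨L, -, hL⟩ := hC x
    simpa only [hL] using L.integrable_comp hG
  induction l generalizing x with
  | nil => exact hF x
  | cons i l ih =>
    obtain ⟨C, hC⟩ := exists_strongDual_gsEmbedding_eq_listDeriv t s h (i :: l)
    have hbound (w : W) (x : RSpace d) :
        ‖listDeriv (i :: l) (G w).toFun x‖ ≤ C * ‖gsEmbedding d t s h (G w)‖ := by
      obtain ⟨L, hLC, hL⟩ := hC x
      rw [← hL]
      exact L.le_of_opNorm_le hLC _
    have hintegral := (hasDerivAt_integral_of_dominated_loc_of_deriv_le (μ := μ) (x₀ := (0 : ℝ))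
      (s := Set.univ) (bound := fun w => C * ‖gsEmbedding d t s h (G w)‖) Filter.univ_mem
      (Filter.Eventually.of_forall fun τ =>
        (hint l (x + τ • EuclideanSpace.single i 1)).aestronglyMeasurable)
      (hint l _) (hint (i :: l) (x + (0 : ℝ) • EuclideanSpace.single i 1)).aestronglyMeasurable
      (Filter.Eventually.of_forall fun w _ _ => hbound w _) (hG.norm.const_mul C)
      (Filter.Eventually.of_forall fun w τ _ => hasDerivAt_listDeriv_line l i (G w) x τ)).2
    have hline := hasDerivAt_listDeriv_line l i F x 0
    simp only [ih] at hline
    simpa using hline.unique hintegral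

lemma gsEmbedding_eq_integral (hG : Integrable (fun w => gsEmbedding d t s h (G w)) μ)
    (hF : ∀ x, F.toFun x = ∫ w, (G w).toFun x ∂μ) :
    gsEmbedding d t s h F = ∫ w, gsEmbedding d t s h (G w) ∂μ := by
  ext p
  refine Eq.trans ?_ ((lp.evalCLM ℂ (fun _ : (Fin d → ℕ) × (Fin d → ℕ) × RSpace d => ℂ) ∞
    p).integral_comp_comm hG)
  change gsCoordinate t s h F.toFun p = ∫ w, gsCoordinate t s h (G w).toFun p ∂μ
  simp only [gsCoordinate, multiDeriv_eq_listDeriv, listDeriv_eq_integral hG hF]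
  rw [integral_div, integral_const_mul]

/- Completeness of `Σ_t^s` is avoided: `u` is bounded by a single seminorm, so by Hahn-Banach it
factors through `gsEmbedding`, and the integral is taken in the Banach space of bounded families. -/
theorem GSDual.apply_eq_integral [TopologicalSpace W] [OpensMeasurableSpace W]
    [SecondCountableTopology W] (u : GSDual d t s) (hG : Continuous G)
    (hint : ∀ h, Integrable (fun w => gsSeminorm d t s h (G w)) μ)
    (hF : ∀ x, F.toFun x = ∫ w, (G w).toFun x ∂μ) : u F = ∫ w, u (G w) ∂μ := by
  obtain ⟨h, C, -, hC⟩ := u.exists_norm_le_gsSeminorm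
  obtain ⟨L, hL⟩ := exists_strongDual_apply_eq (gsEmbedding d t s h)
    ((starLinearEquiv ℂ).toLinearMap.comp u.toLinearMap) (C := C) fun f => by
      simpa [norm_gsEmbedding] using hC f
  have hJ : Integrable (fun w => gsEmbedding d t s h (G w)) μ :=
    (hint h).mono' ((continuous_gsEmbedding h).comp hG).aestronglyMeasurable
      (Filter.Eventually.of_forall fun w => (norm_gsEmbedding h (G w)).le)
  refine star_injective ?_
  calc star (u F) = L (gsEmbedding d t s h F) := (hL F).symm
    _ = ∫ w, L (gsEmbedding d t s h (G w)) ∂μ := by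
      rw [gsEmbedding_eq_integral hJ hF, L.integral_comp_comm hJ]
    _ = ∫ w, star (u (G w)) ∂μ := integral_congr_ae (Filter.Eventually.of_forall fun w => hL (G w))
    _ = star (∫ w, u (G w) ∂μ) := integral_conj

end Integral

end Functionals

section FourierDecay

open scoped ContDiff Nat FourierTransform
open MeasureTheory

variable {V E : Type*} [NormedAddCommGroup V] [InnerProductSpace ℝ V] [FiniteDimensional ℝ V]
  [MeasurableSpace V] [BorelSpace V] [NormedAddCommGroup E] [NormedSpace ℂ E]

lemma pow_mul_norm_fourier_le {f : V → E} (hf : ContDiff ℝ ∞ f)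
    (hint : ∀ n : ℕ, Integrable (iteratedFDeriv ℝ n f)) (n : ℕ) (w : V) :
    (2 * Real.pi * ‖w‖) ^ n * ‖𝓕 f w‖ ≤ ∫ x, ‖iteratedFDeriv ℝ n f x‖ := by
  set e : V := ‖w‖⁻¹ • w
  have he : ‖fun _ : Fin n => e‖ ≤ 1 := by
    refine (pi_norm_le_iff_of_nonneg zero_le_one).2 fun _ => ?_
    rw [norm_smul, norm_inv, norm_norm]
    exact inv_mul_le_one
  have hwe : inner ℝ w e = ‖w‖ := by
    rcases eq_or_ne w 0 with rfl | hw
    · simp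
    · rw [inner_smul_right, real_inner_self_eq_norm_mul_norm, ← mul_assoc,
        inv_mul_cancel₀ (norm_ne_zero_iff.2 hw), one_mul]
  have hfourier := congrFun (Real.fourier_iteratedFDeriv (N := ⊤) hf (fun n _ => hint n)
    (n := n) le_top) w
  calc (2 * Real.pi * ‖w‖) ^ n * ‖𝓕 f w‖ = ‖𝓕 (iteratedFDeriv ℝ n f) w fun _ => e‖ := by
        rw [hfourier, VectorFourier.fourierPowSMulRight_apply]
        simp [innerSL_apply_apply ℝ, hwe, norm_smul, mul_pow, mul_assoc, abs_of_pos Real.pi_pos]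
    _ ≤ ‖𝓕 (iteratedFDeriv ℝ n f) w‖ := ContinuousMultilinearMap.unit_le_opNorm _ he
    _ ≤ ∫ x, ‖iteratedFDeriv ℝ n f x‖ :=
        VectorFourier.norm_fourierIntegral_le_integral_norm _ _ _ _ _

lemma norm_fourier_mul_exp_le {s h : ℝ} (hs : 0 < s) (hh : 0 < h) {f : V → E} {g : V → ℝ}
    (hf : ContDiff ℝ ∞ f) (hg : Integrable g) (H : ∀ x, GevreyBoundAt s h (g x) f x) (w : V) :
    ‖𝓕 f w‖ * Real.exp (s / 2 * (2 * Real.pi * ‖w‖ / h) ^ s⁻¹) ≤ 2 ^ s * ∫ x, g x := by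
  have hint (n : ℕ) : Integrable (iteratedFDeriv ℝ n f) :=
    (hg.mul_const _).mono' (hf.continuous_iteratedFDeriv (mod_cast le_top)).aestronglyMeasurable
      (Filter.Eventually.of_forall fun x => H x n)
  refine mul_exp_le_of_forall_mul_pow_le hs hh (norm_nonneg _)
    (integral_nonneg fun x => (H x).nonneg) (by positivity) fun n => ?_
  calc ‖𝓕 f w‖ * (2 * Real.pi * ‖w‖) ^ n ≤ ∫ x, ‖iteratedFDeriv ℝ n f x‖ := by
        rw [mul_comm]
        exact pow_mul_norm_fourier_le hf hint n w
    _ ≤ ∫ x, g x * (h ^ n * (n ! : ℝ) ^ s) :=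
        integral_mono (hint n).norm (hg.mul_const _) fun x => H x n
    _ = (∫ x, g x) * (h ^ n * (n ! : ℝ) ^ s) := integral_mul_const _ _

end FourierDecay

section Integrability

open MeasureTheory

variable {t s : ℝ}

lemma integrable_exp_neg_norm_rpow_inv {E : Type*} [NormedAddCommGroup E] [NormedSpace ℝ E]
    [FiniteDimensional ℝ E] [MeasurableSpace E] [BorelSpace E] (μ : Measure E)
    [μ.IsAddHaarMeasure] (ht : 0 < t) : Integrable (fun x : E => Real.exp (-‖x‖ ^ t⁻¹)) μ := by
  set n := Module.finrank ℝ E + 1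
  obtain ⟨K, _, hK⟩ := exists_pow_le_exp_rpow_inv ht n
  have hint : Integrable (fun x : E => (1 + ‖x‖) ^ (-(n : ℝ))) μ :=
    integrable_one_add_norm (by simp [n])
  refine (hint.const_mul (2 ^ n * (1 + K))).mono'
    (Real.continuous_exp.comp (continuous_norm_rpow_inv ht).neg).aestronglyMeasurable
    (Filter.Eventually.of_forall fun x => ?_)
  have hexp : 1 ≤ Real.exp (‖x‖ ^ t⁻¹) := Real.one_le_exp (by positivity)
  have hpow : (1 + ‖x‖) ^ n ≤ 2 ^ n * (1 + K) * Real.exp (‖x‖ ^ t⁻¹) :=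
    calc (1 + ‖x‖) ^ n ≤ 2 ^ n * (1 ^ n + ‖x‖ ^ n) := by
          refine (add_pow_le zero_le_one (norm_nonneg x) n).trans ?_
          gcongr
          exacts [one_le_two, Nat.sub_le _ _]
      _ ≤ 2 ^ n * (Real.exp (‖x‖ ^ t⁻¹) + K * Real.exp (‖x‖ ^ t⁻¹)) := by
          rw [one_pow]
          gcongr
          exact hK _ (norm_nonneg x)
      _ = 2 ^ n * (1 + K) * Real.exp (‖x‖ ^ t⁻¹) := by ring
  rw [Real.norm_of_nonneg (Real.exp_pos _).le, Real.exp_neg, Real.rpow_neg (by positivity),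
    Real.rpow_natCast, ← div_eq_mul_inv, le_div_iff₀ (by positivity),
    inv_mul_le_iff₀ (Real.exp_pos _), mul_comm (Real.exp _)]
  exact hpow

lemma integrable_exp_neg_phaseWeight (ht : 0 < t) (hs : 0 < s) :
    Integrable fun z : PhaseSpace d => Real.exp (-phaseWeight t s z) := by
  simp_rw [phaseWeight, neg_add, Real.exp_add, Measure.volume_eq_prod]
  exact (integrable_exp_neg_norm_rpow_inv volume ht).mul_prod
    (integrable_exp_neg_norm_rpow_inv volume hs)

lemma GSSpace.exists_norm_le (ht : 0 < t) (hs : 0 < s) (f : GSSpace d t s) :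
    ∃ C : ℝ, ∀ x, ‖f.toFun x‖ ≤ C := by
  obtain ⟨C, hC⟩ := f.exists_gevreyDecay ht hs one_pos one_pos
  exact ⟨C, fun x => (hC.norm_le x).trans (mul_le_of_le_one_right hC.nonneg
    (Real.exp_le_one_iff.2 (neg_nonpos.2 (by positivity))))⟩

lemma GSSpace.integrable (ht : 0 < t) (hs : 0 < s) (f : GSSpace d t s) : Integrable f.toFun := by
  obtain ⟨C, hC⟩ := f.exists_gevreyDecay ht hs one_pos one_pos
  refine ((integrable_exp_neg_norm_rpow_inv volume ht).const_mul C).mono'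
    f.contDiff.continuous.aestronglyMeasurable (Filter.Eventually.of_forall fun x => ?_)
  simpa using hC.norm_le x

end Integrability

section Windows

open scoped ContDiff FourierTransform
open MeasureTheory

lemma norm_character (ξ y : RSpace d) : ‖character ξ y‖ = 1 := by
  rw [character, mul_comm, Complex.norm_exp_ofReal_mul_I]

lemma star_character (ξ y : RSpace d) : star (character ξ y) = character (-ξ) y := by
  simp [character, ← Complex.exp_conj]

lemma character_apply_add (ξ x y : RSpace d) :
    character ξ (x + y) = character ξ x * character ξ y := by
  rw [character, character, character, ← Complex.exp_add, inner_add_left, Complex.ofReal_add,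
    mul_add]

/-- The `L²` pairing `(θ, e^{i⟨·,ξ⟩} ψ(· - x))` of `θ` with a time-frequency shift of the window
`ψ`, at `z = (x, ξ)`. -/
def windowPairing (ψ θ : RSpace d → ℂ) (z : PhaseSpace d) : ℂ :=
  ∫ x, star (character z.2 x * ψ (x - z.1)) * θ x

lemma windowPairing_eq_fourier (ψ θ : RSpace d → ℂ) (z : PhaseSpace d) :
    windowPairing ψ θ z =
      𝓕 (fun x => star (ψ (x - z.1)) * θ x) ((2 * Real.pi)⁻¹ • z.2) := by
  rw [windowPairing, Real.fourier_eq']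
  refine integral_congr_ae (Filter.Eventually.of_forall fun x => ?_)
  have hinner : inner ℝ x (-z.2) = -2 * Real.pi * inner ℝ x ((2 * Real.pi)⁻¹ • z.2) := by
    rw [inner_smul_right, inner_neg_right]
    field_simp
  simp only [star_mul', star_character]
  rw [character, hinner, mul_comm Complex.I, smul_eq_mul, mul_assoc]

lemma continuous_windowPairing {ψ θ : RSpace d → ℂ} {B : ℝ} (hψ : Continuous ψ)
    (hB : ∀ x, ‖ψ x‖ ≤ B) (hθ : Integrable θ) : Continuous (windowPairing ψ θ) := by
  refine continuous_of_dominated (bound := fun x => B * ‖θ x‖) (fun z => ?_)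
    (fun z => Filter.Eventually.of_forall fun x => ?_) (hθ.norm.const_mul B)
    (Filter.Eventually.of_forall fun x => ?_)
  · have hc := (contDiff_character z.2).continuous
    exact Continuous.aestronglyMeasurable (by fun_prop) |>.mul hθ.aestronglyMeasurable
  · rw [norm_mul, norm_star, norm_mul, norm_character, one_mul]
    exact mul_le_mul_of_nonneg_right (hB _) (norm_nonneg _)
  · unfold character
    fun_prop

lemma norm_windowPairing_shift (ψ θ : RSpace d → ℂ) (z w : PhaseSpace d) :
    ‖windowPairing ψ (fun x => character z.2 x * θ (x - z.1)) w‖ =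
      ‖windowPairing ψ θ (w - z)‖ := by
  have hphase (x : RSpace d) :
      star (character w.2 (x + z.1) * ψ (x + z.1 - w.1)) *
        (character z.2 (x + z.1) * θ (x + z.1 - z.1)) =
      character (z.2 - w.2) z.1 *
        (star (character (w.2 - z.2) x * ψ (x - (w.1 - z.1))) * θ x) := by
    have hx : x + z.1 - w.1 = x - (w.1 - z.1) := by abel
    rw [hx, add_sub_cancel_right, star_mul', star_mul', star_character, star_character, neg_sub,
      sub_eq_add_neg z.2, character_add, character_add, character_apply_add, character_apply_add]
    ring
  rw [windowPairing, ← integral_add_right_eq_self _ z.1]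
  simp_rw [hphase]
  rw [integral_const_mul, norm_mul, norm_character, one_mul]
  rfl

variable {t s : ℝ}

lemma GevreyDecay.star {f : RSpace d → ℂ} {h r C : ℝ} (H : GevreyDecay t s h r C f) :
    GevreyDecay t s h r C fun x => star (f x) :=
  ⟨Complex.conjLIE.toContinuousLinearEquiv.contDiff.comp H.contDiff, fun x n =>
    (Complex.conjLIE.norm_iteratedFDeriv_comp_left f x n).trans_le (H.boundAt x n)⟩

lemma exists_gevreyBoundAt_windowed (ht : 0 < t) (hs : 0 < s) (ψ θ : GSSpace d t s) {h r : ℝ}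
    (hh : 0 < h) (hr : 0 < r) : ∃ C : ℝ, 0 ≤ C ∧ ∀ a x : RSpace d,
      GevreyBoundAt s h (C * Real.exp (-(r * ‖a‖ ^ t⁻¹)) * Real.exp (-‖x‖ ^ t⁻¹))
        (fun x => star (ψ.toFun (x - a)) * θ.toFun x) x := by
  set R : ℝ := r * 2 ^ t⁻¹
  have hR : 0 < R := by positivity
  obtain ⟨B, hB⟩ := ψ.exists_gevreyDecay ht hs (half_pos hh) hR
  obtain ⟨A, hA⟩ := θ.exists_gevreyDecay ht hs (half_pos hh) (by positivity : 0 < R + 1)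
  have hAB : 0 ≤ B * A := mul_nonneg hB.nonneg hA.nonneg
  refine ⟨B * A, hAB, fun a x => ?_⟩
  have hψa : ContDiff ℝ ∞ fun x => star (ψ.toFun (x - a)) :=
    hB.star.contDiff.comp (contDiff_id.sub contDiff_const)
  have hBa : GevreyBoundAt s (h / 2) (B * Real.exp (-(R * ‖x - a‖ ^ t⁻¹)))
      (fun x => star (ψ.toFun (x - a))) x := fun n => by
    rw [iteratedFDeriv_comp_sub (f := fun x => star (ψ.toFun x))]
    exact hB.star.boundAt (x - a) n
  have hmul := hBa.mul hs.le (by positivity) hψa hA.contDiff (hA.boundAt x)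
  rw [mul_div_cancel₀ h two_ne_zero] at hmul
  refine hmul.mono hh.le ?_
  have hpeetre := exp_neg_norm_rpow_le ht hr.le a x
  calc B * Real.exp (-(R * ‖x - a‖ ^ t⁻¹)) * (A * Real.exp (-((R + 1) * ‖x‖ ^ t⁻¹)))
      = B * A * (Real.exp (-(R * ‖x - a‖ ^ t⁻¹)) * Real.exp (-(R * ‖x‖ ^ t⁻¹))) *
          Real.exp (-‖x‖ ^ t⁻¹) := by
        rw [add_mul, one_mul, neg_add, Real.exp_add]
        ring
    _ ≤ B * A * (Real.exp (-(R * ‖x - a‖ ^ t⁻¹)) *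
          (Real.exp (R * ‖x - a‖ ^ t⁻¹) * Real.exp (-(r * ‖a‖ ^ t⁻¹)))) *
          Real.exp (-‖x‖ ^ t⁻¹) := by gcongr
    _ = _ := by rw [← mul_assoc (Real.exp _), ← Real.exp_add, neg_add_cancel, Real.exp_zero,
          one_mul]

lemma exists_norm_windowPairing_le (ht : 0 < t) (hs : 0 < s) (ψ θ : GSSpace d t s) {r : ℝ}
    (hr : 0 < r) : ∃ C : ℝ, 0 ≤ C ∧ ∀ z,
      ‖windowPairing ψ.toFun θ.toFun z‖ ≤ C * Real.exp (-(r * phaseWeight t s z)) := by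
  set h : ℝ := (s / (2 * r)) ^ s with hh
  obtain ⟨C, hC0, hC⟩ := exists_gevreyBoundAt_windowed ht hs ψ θ (by positivity : 0 < h) hr
  set I : ℝ := ∫ x : RSpace d, Real.exp (-‖x‖ ^ t⁻¹)
  have : 0 ≤ I := integral_nonneg fun _ => (Real.exp_pos _).le
  refine ⟨2 ^ s * (C * I), by positivity, fun z => ?_⟩
  have hsmooth : ContDiff ℝ ∞ fun x => star (ψ.toFun (x - z.1)) * θ.toFun x :=
    (Complex.conjLIE.toContinuousLinearEquiv.contDiff.comp
      (ψ.contDiff.comp (contDiff_id.sub contDiff_const))).mul θ.contDiff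
  have hdecay := norm_fourier_mul_exp_le hs (by positivity) hsmooth
    ((integrable_exp_neg_norm_rpow_inv volume ht).const_mul _) (hC z.1) ((2 * Real.pi)⁻¹ • z.2)
  have hnorm : 2 * Real.pi * ‖(2 * Real.pi)⁻¹ • z.2‖ = ‖z.2‖ := by
    rw [norm_smul, Real.norm_of_nonneg (by positivity), mul_inv_cancel_left₀ (by positivity)]
  have hexp : s / 2 * (‖z.2‖ / h) ^ s⁻¹ = r * ‖z.2‖ ^ s⁻¹ := by
    rw [Real.div_rpow (norm_nonneg _) (by positivity), hh,
      Real.rpow_rpow_inv (by positivity) hs.ne']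
    field_simp
  rw [← windowPairing_eq_fourier, hnorm, hexp, integral_const_mul] at hdecay
  calc ‖windowPairing ψ.toFun θ.toFun z‖
      = ‖windowPairing ψ.toFun θ.toFun z‖ * Real.exp (r * ‖z.2‖ ^ s⁻¹) *
          Real.exp (-(r * ‖z.2‖ ^ s⁻¹)) := by
        rw [mul_assoc, ← Real.exp_add, add_neg_cancel, Real.exp_zero, mul_one]
    _ ≤ 2 ^ s * (C * Real.exp (-(r * ‖z.1‖ ^ t⁻¹)) * I) * Real.exp (-(r * ‖z.2‖ ^ s⁻¹)) := by
        gcongr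
    _ = 2 ^ s * (C * I) * Real.exp (-(r * phaseWeight t s z)) := by
        rw [phaseWeight, mul_add, neg_add, Real.exp_add]
        ring

lemma integral_windowPairing_mul_character {ψ θ : RSpace d → ℂ} (y : RSpace d)
    (hψ : Continuous ψ) (hθ : Continuous θ)
    (hint : Integrable fun x => star (ψ (x - y)) * θ x)
    (hint' : Integrable fun ξ => windowPairing ψ θ (y, ξ)) (v : RSpace d) :
    ∫ ξ, windowPairing ψ θ (y, ξ) * character ξ v =
      (2 * Real.pi) ^ d * (star (ψ (v - y)) * θ v) := by
  set q : RSpace d → ℂ := fun x => star (ψ (x - y)) * θ x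
  set g : RSpace d → ℂ := fun η =>
    Complex.exp (((2 * Real.pi * inner ℝ η v : ℝ) : ℂ) * Complex.I) • 𝓕 q η
  have hpi : (2 * Real.pi : ℝ) ≠ 0 := by positivity
  have hpair (ξ : RSpace d) : windowPairing ψ θ (y, ξ) = 𝓕 q ((2 * Real.pi)⁻¹ • ξ) :=
    windowPairing_eq_fourier ψ θ (y, ξ)
  have hqF : Integrable (𝓕 q) := by
    simpa only [hpair, integrable_comp_smul_iff volume (𝓕 q) (inv_ne_zero hpi)] using hint'
  have hinv : ∫ η, g η = q v := by
    rw [← Real.fourierInv_eq', (by fun_prop : Continuous q).fourierInv_fourier_eq hint hqF]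
  calc ∫ ξ, windowPairing ψ θ (y, ξ) * character ξ v = ∫ ξ, g ((2 * Real.pi)⁻¹ • ξ) := by
        refine integral_congr_ae (Filter.Eventually.of_forall fun ξ => ?_)
        have hinner : 2 * Real.pi * inner ℝ ((2 * Real.pi)⁻¹ • ξ) v = inner ℝ v ξ := by
          rw [real_inner_smul_left, mul_inv_cancel_left₀ hpi, real_inner_comm]
        simp only [g, hpair, character, hinner, smul_eq_mul, mul_comm Complex.I,
          mul_comm (𝓕 q _)]
    _ = |(2 * Real.pi) ^ d| • q v := by
        rw [Measure.integral_comp_inv_smul volume g, finrank_euclideanSpace_fin, hinv]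
    _ = (2 * Real.pi) ^ d * (star (ψ (v - y)) * θ v) := by
        rw [abs_of_pos (by positivity), Complex.real_smul]
        push_cast
        rfl

lemma exists_norm_windowPairing_mul_exp_le (ht : 0 < t) (hs : 0 < s) (ψ θ : GSSpace d t s)
    {r : ℝ} (hr : 0 ≤ r) : ∃ C : ℝ, 0 ≤ C ∧ ∀ z,
      ‖windowPairing ψ.toFun θ.toFun z‖ * Real.exp (r * phaseWeight t s z) ≤
        C * Real.exp (-phaseWeight t s z) := by
  obtain ⟨C, hC0, hC⟩ := exists_norm_windowPairing_le ht hs ψ θ (by positivity : 0 < r + 1)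
  refine ⟨C, hC0, fun z => ?_⟩
  calc ‖windowPairing ψ.toFun θ.toFun z‖ * Real.exp (r * phaseWeight t s z)
      ≤ C * Real.exp (-((r + 1) * phaseWeight t s z)) * Real.exp (r * phaseWeight t s z) := by
        gcongr
        exact hC z
    _ = C * Real.exp (-phaseWeight t s z) := by
        rw [mul_assoc, ← Real.exp_add]
        ring_nf

lemma GSSpace.continuous_windowPairing (ht : 0 < t) (hs : 0 < s) (ψ θ : GSSpace d t s) :
    Continuous (windowPairing ψ.toFun θ.toFun) := by
  obtain ⟨B, hB⟩ := ψ.exists_norm_le ht hs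
  exact GelfandShilov.continuous_windowPairing ψ.contDiff.continuous hB (θ.integrable ht hs)

lemma integrable_windowPairing_mul_timeFreqShift (ht : 0 < t) (hs : 0 < s)
    (ψ θ : GSSpace d t s) (v : RSpace d) : Integrable fun z : PhaseSpace d =>
      windowPairing ψ.toFun θ.toFun z * (timeFreqShift ht hs z.1 z.2 ψ).toFun v := by
  obtain ⟨B, hB⟩ := ψ.exists_norm_le ht hs
  obtain ⟨C, _, hC⟩ := exists_norm_windowPairing_le ht hs ψ θ one_pos
  have hψ := ψ.contDiff.continuous
  have hcont := ψ.continuous_windowPairing ht hs θ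
  change Integrable fun z : PhaseSpace d =>
    windowPairing ψ.toFun θ.toFun z * (character z.2 v * ψ.toFun (v - z.1))
  refine ((integrable_exp_neg_phaseWeight ht hs).const_mul (C * B)).mono'
    (Continuous.aestronglyMeasurable (by unfold character; fun_prop))
    (Filter.Eventually.of_forall fun z => ?_)
  have hCz := hC z
  rw [one_mul] at hCz
  rw [norm_mul, norm_mul, norm_character, one_mul, mul_right_comm]
  exact mul_le_mul hCz (hB _) (norm_nonneg _) ((norm_nonneg _).trans hCz)

lemma integrable_windowPairing_frequency (ht : 0 < t) (hs : 0 < s) (ψ θ : GSSpace d t s)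
    (y : RSpace d) : Integrable fun ξ => windowPairing ψ.toFun θ.toFun (y, ξ) := by
  obtain ⟨C, _, hC⟩ := exists_norm_windowPairing_le ht hs ψ θ one_pos
  have hcont := ψ.continuous_windowPairing ht hs θ
  refine ((integrable_exp_neg_norm_rpow_inv volume hs).const_mul C).mono'
    (by fun_prop : Continuous _).aestronglyMeasurable (Filter.Eventually.of_forall fun ξ => ?_)
  refine (hC (y, ξ)).trans ?_
  rw [one_mul, phaseWeight]
  gcongr
  exact le_add_of_nonneg_left (by positivity)

lemma integral_windowPairing_mul_timeFreqShift (ht : 0 < t) (hs : 0 < s) (ψ θ : GSSpace d t s)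
    (v : RSpace d) :
    ∫ z, windowPairing ψ.toFun θ.toFun z * (timeFreqShift ht hs z.1 z.2 ψ).toFun v =
      (2 * Real.pi) ^ d * (∫ x, (‖ψ.toFun x‖ ^ 2 : ℝ) : ℝ) * θ.toFun v := by
  obtain ⟨B, hB⟩ := ψ.exists_norm_le ht hs
  have hψ := ψ.contDiff.continuous
  have hwindowed (y : RSpace d) : Integrable fun x => star (ψ.toFun (x - y)) * θ.toFun x :=
    (θ.integrable ht hs).bdd_mul (by fun_prop : Continuous _).aestronglyMeasurable
      (Filter.Eventually.of_forall fun x => (norm_star _).trans_le (hB (x - y)))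
  calc ∫ z : PhaseSpace d, windowPairing ψ.toFun θ.toFun z *
        (character z.2 v * ψ.toFun (v - z.1))
      = ∫ y, (∫ ξ, windowPairing ψ.toFun θ.toFun (y, ξ) * character ξ v) *
          ψ.toFun (v - y) := by
        refine (integral_prod _
          (integrable_windowPairing_mul_timeFreqShift ht hs ψ θ v)).trans ?_
        simp_rw [← integral_mul_const, mul_assoc]
        rfl
    _ = ∫ y, (2 * Real.pi) ^ d * θ.toFun v * (‖ψ.toFun (v - y)‖ ^ 2 : ℝ) := by
        refine integral_congr_ae (Filter.Eventually.of_forall fun y => ?_)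
        simp only [integral_windowPairing_mul_character y hψ θ.contDiff.continuous (hwindowed y)
          (integrable_windowPairing_frequency ht hs ψ θ y) v, Complex.ofReal_pow,
          ← Complex.conj_mul', starRingEnd_apply]
        ring
    _ = _ := by
        rw [integral_const_mul, integral_complex_ofReal,
          integral_sub_left_eq_self (fun x => ‖ψ.toFun x‖ ^ 2) volume v]
        ring

lemma GSSpace.integral_norm_sq_pos (ht : 0 < t) (hs : 0 < s) {ψ : GSSpace d t s} (hψ : ψ ≠ 0) :
    0 < ∫ x, ‖ψ.toFun x‖ ^ 2 := by
  obtain ⟨x₀, hx₀⟩ : ∃ x, ψ.toFun x ≠ 0 := by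
    by_contra! hzero
    exact hψ (Subtype.ext (funext hzero))
  obtain ⟨B, hB⟩ := ψ.exists_norm_le ht hs
  have hc := ψ.contDiff.continuous
  have hint : Integrable fun x => ‖ψ.toFun x‖ ^ 2 := by
    simp_rw [sq]
    exact (ψ.integrable ht hs).norm.bdd_mul hc.norm.aestronglyMeasurable
      (Filter.Eventually.of_forall fun x => (norm_norm _).trans_le (hB x))
  rw [integral_pos_iff_support_of_nonneg (fun x => by positivity) hint]
  exact IsOpen.measure_pos _ (hc.norm.pow 2).isOpen_support ⟨x₀, by simpa using hx₀⟩

lemma GSDual.apply_eq_integral_windowPairing (ht : 0 < t) (hs : 0 < s) {ψ : GSSpace d t s}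
    (hψ : ψ ≠ 0) (u : GSDual d t s) (θ : GSSpace d t s) :
    u θ = ((2 * Real.pi) ^ d * ∫ x, ‖ψ.toFun x‖ ^ 2 : ℝ)⁻¹ *
      ∫ z, star (windowPairing ψ.toFun θ.toFun z) * u (timeFreqShift ht hs z.1 z.2 ψ) := by
  set c : ℝ := (2 * Real.pi) ^ d * ∫ x, ‖ψ.toFun x‖ ^ 2 with hc
  have hc0 : (c : ℂ) ≠ 0 := by
    have := GSSpace.integral_norm_sq_pos ht hs hψ
    exact Complex.ofReal_ne_zero.2 (by positivity)
  have hG : Continuous fun z =>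
      windowPairing ψ.toFun θ.toFun z • timeFreqShift ht hs z.1 z.2 ψ :=
    (ψ.continuous_windowPairing ht hs θ).smul (continuous_timeFreqShift ht hs ψ)
  have hint (h : Set.Ioi (0 : ℝ)) : Integrable fun z => gsSeminorm d t s h
      (windowPairing ψ.toFun θ.toFun z • timeFreqShift ht hs z.1 z.2 ψ) := by
    obtain ⟨A, r, hA, hr, hshift⟩ := exists_gsSeminorm_timeFreqShift_le ht hs h ψ
    obtain ⟨C, _, hC⟩ := exists_norm_windowPairing_mul_exp_le ht hs ψ θ hr.le
    refine ((integrable_exp_neg_phaseWeight ht hs).const_mul (A * C)).mono'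
      (((withSeminorms_gsSeminorm d t s).continuous_seminorm h).comp hG).aestronglyMeasurable
      (Filter.Eventually.of_forall fun z => ?_)
    rw [Real.norm_of_nonneg (apply_nonneg _ _), map_smul_eq_mul]
    calc ‖windowPairing ψ.toFun θ.toFun z‖ * gsSeminorm d t s h (timeFreqShift ht hs z.1 z.2 ψ)
        ≤ ‖windowPairing ψ.toFun θ.toFun z‖ * (A * Real.exp (r * phaseWeight t s z)) := by
          gcongr
          exact hshift z
      _ ≤ A * C * Real.exp (-phaseWeight t s z) := by
          rw [mul_left_comm, mul_assoc]
          exact mul_le_mul_of_nonneg_left (hC z) hA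
  have happly := u.apply_eq_integral (F := (c : ℂ) • θ) hG hint fun v => by
    change (c : ℂ) * θ.toFun v = _
    rw [hc]
    push_cast
    exact (integral_windowPairing_mul_timeFreqShift ht hs ψ θ v).symm
  simp only [map_smulₛₗ, smul_eq_mul, Complex.conj_ofReal] at happly
  rw [eq_comm, Complex.ofReal_inv, inv_mul_eq_iff_eq_mul₀ hc0]
  exact happly.symm

lemma norm_stft_le_integral (ht : 0 < t) (hs : 0 < s) {ψ : GSSpace d t s} (hψ : ψ ≠ 0)
    (φ : GSSpace d t s) (u : GSDual d t s) (z : PhaseSpace d) :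
    ‖stft ht hs φ u z‖ ≤ ((2 * Real.pi) ^ d * ∫ x, ‖ψ.toFun x‖ ^ 2)⁻¹ *
      ∫ w, ‖windowPairing ψ.toFun φ.toFun w‖ * ‖stft ht hs ψ u (z + w)‖ := by
  have hc := GSSpace.integral_norm_sq_pos ht hs hψ
  set θ := timeFreqShift ht hs z.1 z.2 φ with hθ
  have hpair (w : PhaseSpace d) : ‖windowPairing ψ.toFun θ.toFun w‖ =
      ‖windowPairing ψ.toFun φ.toFun (w - z)‖ := norm_windowPairing_shift ψ.toFun φ.toFun z w
  rw [stft, ← hθ, u.apply_eq_integral_windowPairing ht hs hψ θ, mul_left_comm, norm_mul,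
    Complex.norm_real, Real.norm_of_nonneg (by positivity)]
  refine mul_le_mul_of_nonneg_left ?_ (by positivity)
  rw [← integral_const_mul]
  refine (norm_integral_le_integral_norm _).trans_eq ?_
  rw [Measure.volume_eq_prod, ← integral_add_left_eq_self _ z]
  refine integral_congr_ae (Filter.Eventually.of_forall fun w => ?_)
  simp only [stft, norm_mul, norm_star, hpair, add_sub_cancel_left, mul_left_comm]

end Windows

section ChangeOfWindow

open MeasureTheory

variable {t s : ℝ}

/-- The anisotropic dilation `(x, ξ) ↦ (l^t x, l^s ξ)` of phase space. -/
def dilate (t s l : ℝ) (z : PhaseSpace d) : PhaseSpace d := (l ^ t • z.1, l ^ s • z.2)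

lemma phaseWeight_dilate (ht : 0 < t) (hs : 0 < s) {l : ℝ} (hl : 0 ≤ l) (z : PhaseSpace d) :
    phaseWeight t s (dilate t s l z) = l * phaseWeight t s z := by
  rw [phaseWeight, phaseWeight, dilate, norm_rpow_smul_rpow_inv ht hl,
    norm_rpow_smul_rpow_inv hs hl, mul_add]

lemma dilate_add (t s l : ℝ) (z w : PhaseSpace d) :
    dilate t s l (z + w) = dilate t s l z + dilate t s l w :=
  Prod.ext (smul_add _ _ _) (smul_add _ _ _)

lemma dilate_dilate_inv (t s : ℝ) {l : ℝ} (hl : 0 < l) (z : PhaseSpace d) :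
    dilate t s l (dilate t s l⁻¹ z) = z := by
  have hcancel (q : ℝ) (x : RSpace d) : l ^ q • l⁻¹ ^ q • x = x := by
    rw [Real.inv_rpow hl.le, smul_inv_smul₀ (Real.rpow_pos_of_pos hl q).ne']
  exact Prod.ext (hcancel t z.1) (hcancel s z.2)

lemma exists_mul_phaseWeight_dilate_add_le (ht : 0 < t) (hs : 0 < s) {r ρ R ε : ℝ} (hr : 0 ≤ r)
    (hρ : 0 ≤ ρ) (hR : 0 ≤ R) (hε : 0 < ε) : ∃ T : ℝ, 0 ≤ T ∧ ∀ l : ℝ, 0 < l →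
      ∀ z w : PhaseSpace d, phaseWeight t s z ≤ R → ε * l ≤ phaseWeight t s w →
        r * phaseWeight t s (dilate t s l z + w) ≤ -(ρ * l) + T * phaseWeight t s w := by
  obtain ⟨K, hK, hquasi⟩ := exists_phaseWeight_add_le (d := d) ht hs
  set A : ℝ := r * K * R + ρ
  have : 0 ≤ A := by positivity
  refine ⟨r * K + A / ε, by positivity, fun l hl z w hz hw => ?_⟩
  have habsorb : A * l ≤ A / ε * phaseWeight t s w := by
    rw [div_mul_eq_mul_div, le_div_iff₀ hε, mul_assoc, mul_comm l]
    gcongr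
  calc r * phaseWeight t s (dilate t s l z + w)
      ≤ r * (K * (l * R + phaseWeight t s w)) := by
        gcongr
        refine (hquasi _ _).trans ?_
        rw [phaseWeight_dilate ht hs hl.le]
        gcongr
    _ = -(ρ * l) + r * K * phaseWeight t s w + A * l := by ring
    _ ≤ -(ρ * l) + r * K * phaseWeight t s w + A / ε * phaseWeight t s w := by gcongr
    _ = -(ρ * l) + (r * K + A / ε) * phaseWeight t s w := by ring

lemma norm_lt_of_phaseWeight_lt (ht : 0 < t) (hs : 0 < s) {δ : ℝ} (hδ : 0 < δ)
    {z : PhaseSpace d} (hz : phaseWeight t s z < min (δ ^ t⁻¹) (δ ^ s⁻¹)) : ‖z‖ < δ := by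
  have hx : 0 ≤ ‖z.1‖ ^ t⁻¹ := by positivity
  have hξ : 0 ≤ ‖z.2‖ ^ s⁻¹ := by positivity
  rw [phaseWeight, lt_min_iff] at hz
  rw [Prod.norm_def, max_lt_iff, ← Real.rpow_lt_rpow_iff (norm_nonneg _) hδ.le (inv_pos.2 ht),
    ← Real.rpow_lt_rpow_iff (norm_nonneg z.2) hδ.le (inv_pos.2 hs)]
  exact ⟨by linarith, by linarith⟩

lemma exists_isOpen_forall_add_mem (ht : 0 < t) (hs : 0 < s) {z₀ : PhaseSpace d}
    {U : Set (PhaseSpace d)} (hU : IsOpen U) (hz₀ : z₀ ∈ U) :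
    ∃ V, IsOpen V ∧ V ⊆ U ∧ z₀ ∈ V ∧ (∀ z ∈ V, phaseWeight t s z ≤ phaseWeight t s z₀ + 1) ∧
      ∃ ε > 0, ∀ z ∈ V, ∀ w, phaseWeight t s w ≤ ε → z + w ∈ U := by
  obtain ⟨δ, hδ, hball⟩ := Metric.isOpen_iff.1 hU z₀ hz₀
  have hδ₂ := half_pos hδ
  obtain ⟨ε, hε, hεδ⟩ := exists_between (lt_min (Real.rpow_pos_of_pos hδ₂ t⁻¹)
    (Real.rpow_pos_of_pos hδ₂ s⁻¹))
  refine ⟨Metric.ball z₀ (δ / 2) ∩ {z | phaseWeight t s z < phaseWeight t s z₀ + 1},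
    Metric.isOpen_ball.inter (isOpen_lt (continuous_phaseWeight ht hs) continuous_const),
    fun z hz => hball (Metric.ball_subset_ball (half_le_self hδ.le) hz.1),
    ⟨Metric.mem_ball_self hδ₂, lt_add_one (phaseWeight t s z₀)⟩, fun z hz => hz.2.le, ε, hε,
    fun z hz w hw => ?_⟩
  refine hball ?_
  rw [← add_zero z₀, ← add_halves δ]
  refine (dist_add_add_le z w z₀ 0).trans_lt (add_lt_add hz.1 ?_)
  rw [dist_zero_right]
  exact norm_lt_of_phaseWeight_lt ht hs hδ₂ (hw.trans_lt hεδ)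

lemma exists_norm_stft_le (ht : 0 < t) (hs : 0 < s) (ψ : GSSpace d t s) (u : GSDual d t s) :
    ∃ C r : ℝ, 0 ≤ C ∧ 0 < r ∧ ∀ z,
      ‖stft ht hs ψ u z‖ ≤ C * Real.exp (r * phaseWeight t s z) := by
  obtain ⟨h, B, hB, hu⟩ := u.exists_norm_le_gsSeminorm
  obtain ⟨C, r, hC, hr, hshift⟩ := exists_gsSeminorm_timeFreqShift_le ht hs h ψ
  refine ⟨(2 * Real.pi) ^ (-((d : ℝ) / 2)) * (B * C), r, by positivity, hr, fun z => ?_⟩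
  rw [stft, norm_mul, Complex.norm_real, Real.norm_of_nonneg (by positivity), mul_assoc, mul_assoc]
  gcongr
  exact (hu _).trans (mul_le_mul_of_nonneg_left (hshift z) hB)

variable {ht : 0 < t} {hs : 0 < s} {u : GSDual d t s} {ψ : GSSpace d t s}
  {U : Set (PhaseSpace d)}

lemma SuperExpDecay.exists_norm_stft_dilate_add_le (H : SuperExpDecay ht hs ψ u U)
    {V : Set (PhaseSpace d)} {R ε ρ : ℝ} (hR0 : 0 ≤ R) (hR : ∀ z ∈ V, phaseWeight t s z ≤ R)
    (hε : 0 < ε) (hadd : ∀ z ∈ V, ∀ w, phaseWeight t s w ≤ ε → z + w ∈ U) (hρ : 0 < ρ) :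
    ∃ M T : ℝ, 0 ≤ M ∧ 0 ≤ T ∧ ∀ l : ℝ, 0 < l → ∀ z ∈ V, ∀ w,
      ‖stft ht hs ψ u (dilate t s l z + w)‖ ≤
        M * Real.exp (-(ρ * l)) * Real.exp (T * phaseWeight t s w) := by
  obtain ⟨D, hD⟩ := H ρ hρ
  obtain ⟨B, r, hB, hr, hgrowth⟩ := exists_norm_stft_le ht hs ψ u
  obtain ⟨T, hT, hfar_weight⟩ :=
    exists_mul_phaseWeight_dilate_add_le (d := d) ht hs hr.le hρ.le hR0 hε
  have hM : 0 ≤ max D B := hB.trans (le_max_right _ _)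
  refine ⟨max D B, T, hM, hT, fun l hl z hz w => ?_⟩
  rcases le_or_gt (phaseWeight t s w) (ε * l) with hnear | hfar
  · have hmem : z + dilate t s l⁻¹ w ∈ U := by
      refine hadd z hz _ ?_
      rwa [phaseWeight_dilate ht hs (inv_nonneg.2 hl.le), inv_mul_le_iff₀ hl, mul_comm]
    have hdecay : Real.exp (ρ * l) * ‖stft ht hs ψ u (dilate t s l z + w)‖ ≤ D := by
      rw [← dilate_dilate_inv t s hl w, ← dilate_add]
      exact hD l hl _ hmem
    calc ‖stft ht hs ψ u (dilate t s l z + w)‖ ≤ D * Real.exp (-(ρ * l)) := by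
          rwa [Real.exp_neg, ← div_eq_mul_inv, le_div_iff₀' (Real.exp_pos _)]
      _ ≤ max D B * Real.exp (-(ρ * l)) := by gcongr; exact le_max_left _ _
      _ ≤ max D B * Real.exp (-(ρ * l)) * Real.exp (T * phaseWeight t s w) :=
          le_mul_of_one_le_right (by positivity)
            (Real.one_le_exp (mul_nonneg hT (phaseWeight_nonneg t s w)))
  · calc ‖stft ht hs ψ u (dilate t s l z + w)‖
        ≤ B * Real.exp (r * phaseWeight t s (dilate t s l z + w)) := hgrowth _
      _ ≤ max D B * Real.exp (-(ρ * l) + T * phaseWeight t s w) := by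
          gcongr
          exacts [le_max_right _ _, hfar_weight l hl z w (hR z hz) hfar.le]
      _ = _ := by rw [Real.exp_add, mul_assoc]

theorem SuperExpDecay.exists_change_window (hψ : ψ ≠ 0) (φ : GSSpace d t s) {z₀ : PhaseSpace d}
    (hU : IsOpen U) (hz₀ : z₀ ∈ U) (H : SuperExpDecay ht hs ψ u U) :
    ∃ V : Set (PhaseSpace d), IsOpen V ∧ V ⊆ U ∧ z₀ ∈ V ∧ SuperExpDecay ht hs φ u V := by
  obtain ⟨V, hV, hVU, hz₀V, hR, ε, hε, hadd⟩ := exists_isOpen_forall_add_mem ht hs hU hz₀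
  refine ⟨V, hV, hVU, hz₀V, fun ρ hρ => ?_⟩
  obtain ⟨M, T, hM, hT, hstft⟩ := H.exists_norm_stft_dilate_add_le
    (add_nonneg (phaseWeight_nonneg t s z₀) zero_le_one) hR hε hadd hρ
  obtain ⟨C, -, hpair⟩ := exists_norm_windowPairing_mul_exp_le ht hs ψ φ hT
  set c : ℝ := ((2 * Real.pi) ^ d * ∫ x, ‖ψ.toFun x‖ ^ 2)⁻¹
  have hc : 0 ≤ c := by positivity
  set I : ℝ := ∫ w : PhaseSpace d, Real.exp (-phaseWeight t s w)
  refine ⟨c * (M * C * I), fun l hl z hz => ?_⟩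
  have hpointwise (w : PhaseSpace d) :
      ‖windowPairing ψ.toFun φ.toFun w‖ * ‖stft ht hs ψ u (dilate t s l z + w)‖ ≤
        Real.exp (-(ρ * l)) * (M * C) * Real.exp (-phaseWeight t s w) :=
    calc _ ≤ ‖windowPairing ψ.toFun φ.toFun w‖ *
          (M * Real.exp (-(ρ * l)) * Real.exp (T * phaseWeight t s w)) := by
          gcongr
          exact hstft l hl z hz w
      _ = M * Real.exp (-(ρ * l)) *
          (‖windowPairing ψ.toFun φ.toFun w‖ * Real.exp (T * phaseWeight t s w)) := by ring
      _ ≤ M * Real.exp (-(ρ * l)) * (C * Real.exp (-phaseWeight t s w)) :=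
          mul_le_mul_of_nonneg_left (hpair w) (by positivity)
      _ = _ := by ring
  have hintegral := integral_mono_of_nonneg (Filter.Eventually.of_forall fun w => by positivity)
    ((integrable_exp_neg_phaseWeight ht hs).const_mul _)
    (Filter.Eventually.of_forall hpointwise)
  rw [integral_const_mul] at hintegral
  calc Real.exp (ρ * l) * ‖stft ht hs φ u (dilate t s l z)‖
      ≤ Real.exp (ρ * l) * (c * (Real.exp (-(ρ * l)) * (M * C) * I)) := by
        gcongr
        exact (norm_stft_le_integral ht hs hψ φ u _).trans
          (mul_le_mul_of_nonneg_left hintegral hc)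
    _ = c * (M * C * I) := by
        rw [Real.exp_neg]
        field_simp

lemma waveFrontSet_subset (ht : 0 < t) (hs : 0 < s) (u : GSDual d t s) (ψ : GSSpace d t s)
    {φ : GSSpace d t s} (hφ : φ ≠ 0) : waveFrontSet ht hs ψ u ⊆ waveFrontSet ht hs φ u := by
  rintro z ⟨hz, hsing⟩
  refine ⟨hz, fun ⟨U, hU, hU0, hzU, H⟩ => hsing ?_⟩
  obtain ⟨V, hV, hVU, hzV, HV⟩ := H.exists_change_window hφ ψ hU hzU
  exact ⟨V, hV, hVU.trans hU0, hzV, HV⟩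

end ChangeOfWindow

end GelfandShilov

end

open GelfandShilov in
theorem proposition3p5 {d : ℕ} {t s : ℝ} (ht : 0 < t) (hs : 0 < s) (hts : 1 < s + t)
    (u : GSDual d t s) (ψ φ : GSSpace d t s) (hψ : ψ ≠ 0) (hφ : φ ≠ 0) :
    (∀ z₀ : PhaseSpace d, z₀ ≠ 0 → ∀ U : Set (PhaseSpace d), IsOpen U → U ⊆ {0}ᶜ → z₀ ∈ U →
      SuperExpDecay ht hs ψ u U →
      ∃ V : Set (PhaseSpace d), IsOpen V ∧ V ⊆ U ∧ z₀ ∈ V ∧ SuperExpDecay ht hs φ u V) ∧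
    waveFrontSet ht hs ψ u = waveFrontSet ht hs φ u :=
  ⟨fun _ _ _ hU _ hz₀ H => H.exists_change_window hψ φ hU hz₀,
    (waveFrontSet_subset ht hs u ψ hφ).antisymm (waveFrontSet_subset ht hs u φ hψ)⟩
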